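/- **Setting.** Fix $p\ge 1$ and a positive definite $\Sigma_0\in\mathbb R^{p\times p}$; put $\Theta_0=\Sigma_0^{-1}$. Let $X_1,X_2,\dots$ be i.i.d. $\mathcal N(0,\Sigma_0)$ vectors in $\mathbb R^p$, and let $X=[x_1|\cdots|x_p]$ be the $n\times p$ matrix whose rows are the first $n$ of them. A DAG is a pair $(B,\Omega)$, where $B=(\beta_{ij})\in\mathbb R^{p\times p}$ is such that the directed graph with an edge $i\to j$ whenever $\beta_{ij}\ne0$ has no directed cycle, and $\Omega=\mathrm{diag}(\omega_1^2,\dots,\omega_p^2)$ with all $\omega_j^2>0$. Put $\Theta(B,\Omega)=(I-B)\Omega^{-1}(I-B)^T$ and let $\mathcal E_0$ be the set of all DAGs $(B,\Omega)$ with $\Theta(B,\Omega)=\Theta_0$. Write $\mathrm{supp}(B)=\{(i,j):\beta_{ij}\neq0\}$; the number of edges of $(B,\Omega)$ is $|\mathrm{supp}(B)|$. For a permutation $\pi$ of $\{1,\dots,p\}$ let $(P_\pi A)_{ij}=a_{\pi(i)\pi(j)}$, let $P_\pi\Theta_0=(I-L)D^{-1}(I-L)^T$ be the unique factorization with $L$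 strictly lower triangular and $D$ diagonal with positive diagonal, and put $\tilde B_0(\pi)=P_{\pi^{-1}}L$, $\tilde\Omega_0(\pi)=P_{\pi^{-1}}D$. Reparametrize a DAG by $\rho_j=1/\omega_j$, $\varphi_{ij}=\beta_{ij}/\omega_j$, $U=\mathrm{diag}(\rho_1,\dots,\rho_p)+(\varphi_{ij})$, and let $\mathcal D\subset\mathbb R^{p\times p}$ be the set of all such $U$, with the subspace topology. For penalty functions $p_{\lambda_n}:[0,\infty)\to\mathbb R$ (which may also involve further shape parameters depending on $n$) put $$F(U)=\sum_{j=1}^p\Big[n\log\rho_j-\tfrac12\|\rho_jx_j-X\varphi_j\|^2\Big]-n\sum_{i\ne j}p_{\lambda_n}(|\varphi_{ij}|),$$ where $\varphi_j$ is the $j$-th column of $(\varphi_{ij})$. A local maximizer of $F$ means a local maximizer over $\mathcal D$; it is identified with the corresponding pair $(\widehat B,\widehat\Omega)$, and $\widehat\Theta=\Theta(\widehat B,\widehat\Omega)$. For $\nu_0\in\mathcal E_0$ with reparametrized coefficients $\varphi^0_{ij}$ let $a_n(\nu_0)$, $b_n(\nu_0)$ be the maxima of $|p_{\lambda_n}'(|\varphi^0_{ij}|)|$,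 $|p_{\lambda_n}''(|\varphi^0_{ij}|)|$, and $c_n(\nu_0)$ the minimum of $p_{\lambda_n}(|\varphi_{ij}^0|)$, over all $(i,j)$ with $\varphi^0_{ij}\ne0$ (conditions on these are void if $\nu_0$ has no edge). Let $\tau(\lambda_n)=\sup_{t\ge0}p_{\lambda_n}(t)\in[0,\infty]$. **Assumptions.** Each $p_{\lambda_n}$ is nondecreasing and concave on $[0,\infty)$ with $p_{\lambda_n}(0)=0$, and $\liminf_{n\to\infty}\liminf_{t\to0^+}p_{\lambda_n}'(t)/\lambda_n>0$. For every $\nu_0\in\mathcal E_0$: $a_n(\nu_0)=O(n^{-1/2})$, $b_n(\nu_0)\to0$, $c_n(\nu_0)=\tau(\lambda_n)+O(n^{-1/2})$; and for every $t=|\varphi_{ij}^0|\neq0$, $p_{\lambda_n}$ is twice differentiable at $t$ for all large $n$, and its second-order Taylor expansion at $t$ is valid on the scale $n^{-1/2}$, that is, for every $M>0$, $$\sup_{|h|\le Mn^{-1/2}} n\,\big|p_{\lambda_n}(t+h)-p_{\lambda_n}(t)-p_{\lambda_n}'(t)h-\tfrac12p_{\lambda_n}''(t)h^2\big|\to0 .$$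 Finally $\lambda_n\to0$, $\lambda_nn^{1/2}\to\infty$, $\limsup_n\tau(\lambda_n)<\infty$ and $\tau(\lambda_n)n^{1/2}\to\infty$. **Conclusion.** For every permutation $\pi$ there is a sequence of statistics $(\widehat B,\widehat\Omega)$ of the data that is, with probability tending to 1, a local maximizer of $F$, and satisfies 1. $\|\widehat B-\tilde B_0(\pi)\|_F+\|\widehat\Omega-\tilde\Omega_0(\pi)\|_F=O_P(n^{-1/2})$, 2. $P(\mathrm{supp}(\widehat B)=\mathrm{supp}(\tilde B_0(\pi)))\to1$, 3. $\|\widehat\Theta-\Theta_0\|_F=O_P(n^{-1/2})$. Furthermore, let $\mathcal M_n=\{\widehat\nu_n(\nu_0):\nu_0\in\mathcal E_0\}$ be any family of such local maximizers, one for each DAG $\nu_0\in\mathcal E_0$, with properties 1–3 for $\nu_0$ in place of $(\tilde B_0(\pi),\tilde\Omega_0(\pi))$. Then with probability tending to 1 the maximum of $F$ over $\mathcal M_n$ is attained at $\widehat\nu_n(\nu^*)$ for some $\nu^*\in\mathcal E_0$ with the fewest edges (hence at the local maximizer of the sparsest DAG, if that DAG is unique); and with probability tending to 1, $F(\widehat\nu_n(\nu^*))>F(\widehat\nu_n(\nu_0))$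 for all fewest-edge $\nu^*\in\mathcal E_0$ and all $\nu_0\in\mathcal E_0$ with strictly more edges than $\nu^*$. (Probabilities of events that are not known to be measurable are understood as: the complement has outer probability tending to 0, and $O_P$ likewise.) -/

import Mathlib

open Matrix MeasureTheory ProbabilityTheory Filter Topology Asymptotics

/-! ### Structural equation models and their parametrizations -/

/-- The square matrix `P_π A` with entries `A (π i) (π j)`. -/
def permMat {p : ℕ} (π : Equiv.Perm (Fin p)) (A : Matrix (Fin p) (Fin p) ℝ) :
    Matrix (Fin p) (Fin p) ℝ :=
  A.submatrix π π

/-- The weighted adjacency matrix `B` (an edge `i → j` where `B i j ≠ 0`) has no directed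
cycle; in particular its diagonal vanishes. -/
def IsDAG {p : ℕ} (B : Matrix (Fin p) (Fin p) ℝ) : Prop :=
  ∀ i, ¬ Relation.TransGen (fun a b => B a b ≠ 0) i i

/-- Diagonal matrices with positive diagonal: the matrices of error variances. -/
def IsVarianceMatrix {p : ℕ} (Om : Matrix (Fin p) (Fin p) ℝ) : Prop :=
  ∃ d : Fin p → ℝ, (∀ j, 0 < d j) ∧ Om = Matrix.diagonal d

/-- The inverse covariance matrix `Θ(B, Ω) = (I - B) Ω⁻¹ (I - B)ᵀ`. -/
noncomputable def thetaOf {p : ℕ} (B Om : Matrix (Fin p) (Fin p) ℝ) :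
    Matrix (Fin p) (Fin p) ℝ :=
  (1 - B) * Om⁻¹ * (1 - B)ᵀ

/-- The equivalence class `ℰ(Θ)` of all DAGs `(B, Ω)` with `Θ(B, Ω) = Θ`. -/
def equivClass {p : ℕ} (Th : Matrix (Fin p) (Fin p) ℝ) :
    Set (Matrix (Fin p) (Fin p) ℝ × Matrix (Fin p) (Fin p) ℝ) :=
  {e | IsDAG e.1 ∧ IsVarianceMatrix e.2 ∧ thetaOf e.1 e.2 = Th}

/-- The support of a matrix. -/
def matSupp {p : ℕ} (B : Matrix (Fin p) (Fin p) ℝ) : Set (Fin p × Fin p) :=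
  {ij | B ij.1 ij.2 ≠ 0}

/-- The number of edges of a DAG. -/
noncomputable def numEdges {p : ℕ} (B : Matrix (Fin p) (Fin p) ℝ) : ℕ :=
  (matSupp B).ncard

/-- The members of `ℰ(Θ)` with the fewest edges. -/
def sparsestDAGs {p : ℕ} (Th : Matrix (Fin p) (Fin p) ℝ) :
    Set (Matrix (Fin p) (Fin p) ℝ × Matrix (Fin p) (Fin p) ℝ) :=
  {s | s ∈ equivClass Th ∧ ∀ e ∈ equivClass Th, numEdges s.1 ≤ numEdges e.1}

/-- The matrix `U = R + Φ`, with `ρ_j = 1 / ω_j` and `φ_ij = β_ij / ω_j`. -/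
noncomputable def toU {p : ℕ} (e : Matrix (Fin p) (Fin p) ℝ × Matrix (Fin p) (Fin p) ℝ) :
    Matrix (Fin p) (Fin p) ℝ :=
  fun i j => if i = j then 1 / √(e.2 j j) else e.1 i j / √(e.2 j j)

/-- The off-diagonal part `Φ` of `U = R + Φ`. -/
def phiOf {p : ℕ} (U : Matrix (Fin p) (Fin p) ℝ) : Matrix (Fin p) (Fin p) ℝ :=
  fun i j => if i = j then 0 else U i j

/-- `B` recovered from `U = R + Φ`: `β_ij = φ_ij / ρ_j`, `β_jj = 0`. -/
noncomputable def toB {p : ℕ} (U : Matrix (Fin p) (Fin p) ℝ) : Matrix (Fin p) (Fin p) ℝ :=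
  fun i j => if i = j then 0 else U i j / U j j

/-- `Ω` recovered from `U = R + Φ`: `ω_j² = 1 / ρ_j²`. -/
noncomputable def toOmega {p : ℕ} (U : Matrix (Fin p) (Fin p) ℝ) : Matrix (Fin p) (Fin p) ℝ :=
  Matrix.diagonal fun j => 1 / (U j j) ^ 2

/-- The parameter space `𝒟` of all `U = R + Φ` such that `Φ` is a DAG and every `ρ_j` is
positive, with the topology of the space of matrices. -/
def dagSpace (p : ℕ) : Set (Matrix (Fin p) (Fin p) ℝ) :=
  {U | IsDAG (phiOf U) ∧ ∀ j, 0 < U j j}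

/-! ### The DAG attached to a permutation -/

/-- Strictly lower triangular matrices. -/
def IsStrictLower {p : ℕ} (L : Matrix (Fin p) (Fin p) ℝ) : Prop :=
  ∀ i j, i ≤ j → L i j = 0

/-- `A = (I - L) D⁻¹ (I - L)ᵀ` with `L` strictly lower triangular and `D` diagonal with positive
diagonal. -/
def IsCholesky {p : ℕ} (A L D : Matrix (Fin p) (Fin p) ℝ) : Prop :=
  IsStrictLower L ∧ IsVarianceMatrix D ∧ A = thetaOf L D

lemma lower_mul_diag {p : ℕ} {M N : Matrix (Fin p) (Fin p) ℝ} (hM : M.IsLowerTriangular)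
    (hN : N.IsLowerTriangular) (i : Fin p) : (M * N) i i = M i i * N i i := by
  rw [Matrix.mul_apply]
  refine Finset.sum_eq_single i (fun k _ hk => ?_) (by simp)
  rcases lt_or_gt_of_ne hk with h | h
  · rw [hN (show OrderDual.toDual i < OrderDual.toDual k from h), mul_zero]
  · rw [hM (show OrderDual.toDual k < OrderDual.toDual i from h), zero_mul]

lemma inv_diagonal_pos {p : ℕ} {d : Fin p → ℝ} (hd : ∀ j, 0 < d j) :
    (Matrix.diagonal d)⁻¹ = Matrix.diagonal (fun j => (d j)⁻¹) := by
  refine Matrix.inv_eq_right_inv ?_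
  rw [Matrix.diagonal_mul_diagonal, ← Matrix.diagonal_one]
  congr 1
  funext j
  exact mul_inv_cancel₀ (hd j).ne'

lemma exists_cholesky {p : ℕ} {A : Matrix (Fin p) (Fin p) ℝ} (hA : A.PosDef) :
    ∃ LD : Matrix (Fin p) (Fin p) ℝ × Matrix (Fin p) (Fin p) ℝ, IsCholesky A LD.1 LD.2 := by
  set W := LDL.lowerInv hA with hW
  have hWl : W.IsLowerTriangular := fun i j h => LDL.lowerInv_triangular hA h
  have hLo : (W⁻¹).IsLowerTriangular := blockTriangular_inv_of_blockTriangular hWl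
  have hs : ∀ i, W i i * W⁻¹ i i = 1 := fun i => by
    rw [← lower_mul_diag hWl hLo, Matrix.mul_inv_of_invertible, Matrix.one_apply_eq]
  set s : Fin p → ℝ := fun i => W⁻¹ i i with hsdef
  have hs0 : ∀ i, s i ≠ 0 := fun i h => by
    have := hs i
    simp only [hsdef] at h
    rw [h] at this; simp at this
  set d : Fin p → ℝ := LDL.diagEntries hA
  have hinj : Function.Injective W.vecMul :=
    Matrix.vecMul_injective_iff_isUnit.2 (isUnit_of_invertible W)
  have hd : ∀ i, 0 < d i := by
    have h1 : (LDL.diag hA).PosDef := by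
      rw [LDL.diag_eq_lowerInv_conj]
      exact hA.mul_mul_conjTranspose_same hinj
    exact Matrix.posDef_diagonal_iff.1 h1
  have key : W⁻¹ * Matrix.diagonal d * (W⁻¹)ᵀ = A := by
    have := LDL.lower_conj_diag hA
    rwa [Matrix.conjTranspose_eq_transpose_of_trivial] at this
  have hd' : ∀ i, 0 < (s i ^ 2 * d i)⁻¹ := fun i =>
    inv_pos.2 (mul_pos (by have := hs0 i; positivity) (hd i))
  refine ⟨(1 - W⁻¹ * Matrix.diagonal (fun i => (s i)⁻¹),
    Matrix.diagonal (fun i => (s i ^ 2 * d i)⁻¹)), ?_, ⟨_, hd', rfl⟩, ?_⟩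
  · intro i j hij
    rcases hij.eq_or_lt with rfl | h
    · simp [Matrix.mul_diagonal]
      rw [mul_inv_cancel₀ (hs0 i)]; simp
    · have : W⁻¹ i j = 0 := hLo h
      simp [Matrix.mul_diagonal, this, h.ne]
  · simp only [thetaOf]
    rw [inv_diagonal_pos hd', sub_sub_cancel, Matrix.transpose_mul, Matrix.diagonal_transpose,
      ← key]
    simp only [← Matrix.mul_assoc]
    congr 1
    simp only [Matrix.mul_assoc, Matrix.diagonal_mul_diagonal]
    congr 2
    funext i
    have := hs0 i
    field_simp

lemma IsCholesky.unique {p : ℕ} {A L D L' D' : Matrix (Fin p) (Fin p) ℝ}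
    (h : IsCholesky A L D) (h' : IsCholesky A L' D') : L = L' ∧ D = D' := by
  obtain ⟨hL, ⟨d, hd, rfl⟩, hA⟩ := h
  obtain ⟨hL', ⟨d', hd', rfl⟩, hA'⟩ := h'
  have low : ∀ {L : Matrix (Fin p) (Fin p) ℝ}, IsStrictLower L →
      (1 - L).IsLowerTriangular ∧ ∀ i, (1 - L) i i = 1 := fun {L} hL =>
    ⟨fun i j h => by
      have hij : i < j := h
      simp [hL i j hij.le, hij.ne], fun i => by simp [hL i i le_rfl]⟩
  obtain ⟨l1, u1⟩ := low hL
  obtain ⟨l2, u2⟩ := low hL'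
  have det1 : ∀ {N : Matrix (Fin p) (Fin p) ℝ}, N.IsLowerTriangular → (∀ i, N i i = 1) →
      IsUnit N.det := fun hN hu => by
    rw [Matrix.det_of_isLowerTriangular _ hN]; simp [hu]
  have hdet2 := det1 l2 u2
  rw [hA] at hA'
  simp only [thetaOf, inv_diagonal_pos hd, inv_diagonal_pos hd'] at hA'
  have hdet1 := det1 l1 u1
  have hLL : 1 - L = 1 - L' → L = L' := fun h => sub_right_injective h
  suffices hN : 1 - L = 1 - L' by
    refine ⟨hLL hN, ?_⟩
    rw [← hN] at hA'
    have hT : IsUnit ((1 - L)ᵀ).det := by rwa [Matrix.det_transpose]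
    let := Matrix.invertibleOfIsUnitDet _ hdet1
    let := Matrix.invertibleOfIsUnitDet _ hT
    have e1 := (Matrix.mul_left_inj_of_invertible _).1 hA'
    have e2 := (Matrix.mul_right_inj_of_invertible _).1 e1
    have e3 := Matrix.diagonal_injective e2
    congr 1
    funext j
    exact inv_injective (congrFun e3 j)
  set N := 1 - L with hNdef
  set N' := 1 - L' with hNdef'
  clear_value N N'
  let := Matrix.invertibleOfIsUnitDet _ hdet1
  let := Matrix.invertibleOfIsUnitDet _ hdet2
  set M := N'⁻¹ * N with hM
  have lM : M.IsLowerTriangular := (blockTriangular_inv_of_blockTriangular l2).mul l1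
  have l1i : (N⁻¹).IsLowerTriangular := blockTriangular_inv_of_blockTriangular l1
  have l3 : (N⁻¹ * N').IsLowerTriangular := l1i.mul l2
  have eq : M * Matrix.diagonal (fun j => (d j)⁻¹)
      = Matrix.diagonal (fun j => (d' j)⁻¹) * (N⁻¹ * N')ᵀ := by
    have t1 : Nᵀ * (N⁻¹)ᵀ = 1 := by
      rw [← Matrix.transpose_mul, Matrix.inv_mul_of_invertible, Matrix.transpose_one]
    rw [Matrix.transpose_mul]
    calc M * Matrix.diagonal (fun j => (d j)⁻¹)
        = N'⁻¹ * (N * Matrix.diagonal (fun j => (d j)⁻¹) * Nᵀ) * (N⁻¹)ᵀ := by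
          simp only [hM, Matrix.mul_assoc, t1, Matrix.mul_one]
      _ = N'⁻¹ * (N' * Matrix.diagonal (fun j => (d' j)⁻¹) * N'ᵀ) * (N⁻¹)ᵀ := by rw [hA']
      _ = _ := by
          simp only [← Matrix.mul_assoc, Matrix.inv_mul_of_invertible, Matrix.one_mul]
  have hM1 : M = 1 := by
    ext i j
    rcases lt_trichotomy i j with h | rfl | h
    · rw [lM h, Matrix.one_apply_ne h.ne]
    · have := lower_mul_diag l2 lM i
      rw [hM, Matrix.mul_inv_cancel_left_of_invertible, ← hM, u1, u2, one_mul] at this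
      rw [← this, Matrix.one_apply_eq]
    · have := congrFun (congrFun eq i) j
      rw [Matrix.mul_diagonal, Matrix.diagonal_mul, Matrix.transpose_apply,
        l3 h, mul_zero] at this
      rw [Matrix.one_apply_ne h.ne']
      exact (mul_eq_zero.1 this).resolve_right (inv_pos.2 (hd j)).ne'
  calc N = N' * M := by rw [hM, Matrix.mul_inv_cancel_left_of_invertible]
    _ = N' := by rw [hM1, Matrix.mul_one]

open Classical in
/-- The pair `(L, D)` of the Cholesky decomposition of `A`; it exists and is unique when `A` is
positive definite. -/
noncomputable def choleskyPair {p : ℕ} (A : Matrix (Fin p) (Fin p) ℝ) :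
    Matrix (Fin p) (Fin p) ℝ × Matrix (Fin p) (Fin p) ℝ :=
  if h : ∃ LD : Matrix (Fin p) (Fin p) ℝ × Matrix (Fin p) (Fin p) ℝ, IsCholesky A LD.1 LD.2
  then h.choose else (0, 1)

lemma choleskyPair_spec {p : ℕ} {A : Matrix (Fin p) (Fin p) ℝ} (hA : A.PosDef) :
    IsCholesky A (choleskyPair A).1 (choleskyPair A).2 := by
  have h := exists_cholesky hA
  rw [choleskyPair, dif_pos h]
  exact h.choose_spec

/-- The coefficient matrix `P_{π⁻¹} L`, where `P_π Θ = (I - L) D⁻¹ (I - L)ᵀ`. -/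
noncomputable def Btilde {p : ℕ} (Th : Matrix (Fin p) (Fin p) ℝ) (π : Equiv.Perm (Fin p)) :
    Matrix (Fin p) (Fin p) ℝ :=
  permMat π⁻¹ (choleskyPair (permMat π Th)).1

/-- The variance matrix `P_{π⁻¹} D`, where `P_π Θ = (I - L) D⁻¹ (I - L)ᵀ`. -/
noncomputable def OmegaTilde {p : ℕ} (Th : Matrix (Fin p) (Fin p) ℝ) (π : Equiv.Perm (Fin p)) :
    Matrix (Fin p) (Fin p) ℝ :=
  permMat π⁻¹ (choleskyPair (permMat π Th)).2

/-! ### The penalized log-likelihood -/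

/-- The log-likelihood (up to an additive constant that depends on `n` and `p` only)
`∑_j (n log ρ_j - ‖ρ_j x_j - X φ_j‖² / 2)` of `U = R + Φ`, given the `n × p` data matrix `X`. -/
noncomputable def logLik {n p : ℕ} (X : Matrix (Fin n) (Fin p) ℝ)
    (U : Matrix (Fin p) (Fin p) ℝ) : ℝ :=
  ∑ j, ((n : ℝ) * Real.log (U j j)
    - (1 / 2) * ∑ k, (U j j * X k j - (X * phiOf U) k j) ^ 2)

/-- The objective `F = log-likelihood - n ∑_{i ≠ j} q(|u_ij|)` for the penalty function `q`. -/
noncomputable def penLogLik {n p : ℕ} (q : ℝ → ℝ) (X : Matrix (Fin n) (Fin p) ℝ)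
    (U : Matrix (Fin p) (Fin p) ℝ) : ℝ :=
  logLik X U - (n : ℝ) * ∑ i, ∑ j, if i = j then 0 else q |U i j|

/-! ### The characteristics of a sequence of penalties

Throughout `pen n` is the penalty function `p_{λ_n}` used for sample size `n`; only its values on
`[0, ∞)` matter. -/

/-- `a_n = max {|p_{λ_n}'(|φ_ij|)| : φ_ij ≠ 0}` (zero if there is no edge). -/
noncomputable def aSeq {p : ℕ} (pen : ℕ → ℝ → ℝ) (U : Matrix (Fin p) (Fin p) ℝ) (n : ℕ) : ℝ :=
  sSup ((fun ij : Fin p × Fin p => |deriv (pen n) (abs (U ij.1 ij.2))|) '' matSupp (phiOf U))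

/-- `b_n = max {|p_{λ_n}''(|φ_ij|)| : φ_ij ≠ 0}` (zero if there is no edge). -/
noncomputable def bSeq {p : ℕ} (pen : ℕ → ℝ → ℝ) (U : Matrix (Fin p) (Fin p) ℝ) (n : ℕ) : ℝ :=
  sSup ((fun ij : Fin p × Fin p => |deriv (deriv (pen n)) (abs (U ij.1 ij.2))|) '' matSupp (phiOf U))

/-- `c_n = min {p_{λ_n}(|φ_ij|) : φ_ij ≠ 0}` (used only if there is an edge). -/
noncomputable def cSeq {p : ℕ} (pen : ℕ → ℝ → ℝ) (U : Matrix (Fin p) (Fin p) ℝ) (n : ℕ) : ℝ :=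
  sInf ((fun ij : Fin p × Fin p => pen n |U ij.1 ij.2|) '' matSupp (phiOf U))

/-- `τ(λ_n) = sup_{t ≥ 0} p_{λ_n}(t)`, possibly infinite. -/
noncomputable def tauSeq (pen : ℕ → ℝ → ℝ) (n : ℕ) : EReal :=
  ⨆ t : {t : ℝ // 0 ≤ t}, ((pen n t : ℝ) : EReal)

/-- Eventually `pen n` is twice differentiable at `t`, and the second-order Taylor expansion of
`pen n` at `t` on the scale `n^{-1/2}` has a remainder `o(1/n)`: for every `M`, the supremum over
`|h| ≤ M n^{-1/2}` of `n |p_n(t+h) - p_n(t) - p_n'(t) h - p_n''(t) h² / 2|` tends to zero. -/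
def SecondOrderExpansion (pen : ℕ → ℝ → ℝ) (t : ℝ) : Prop :=
  (∀ᶠ n in atTop, (∀ᶠ s in 𝓝 t, DifferentiableAt ℝ (pen n) s) ∧
    DifferentiableAt ℝ (deriv (pen n)) t) ∧
  ∀ M : ℝ, 0 < M → ∀ ε : ℝ, 0 < ε → ∀ᶠ n : ℕ in atTop, ∀ h : ℝ, |h| ≤ M / √(n : ℝ) →
    (n : ℝ) * |pen n (t + h) - pen n t - deriv (pen n) t * h
      - deriv (deriv (pen n)) t / 2 * h ^ 2| ≤ ε

/-! ### Asymptotics in probability -/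

/-- The Frobenius norm. -/
noncomputable def frobNorm {p : ℕ} (A : Matrix (Fin p) (Fin p) ℝ) : ℝ :=
  Matrix.frobeniusNormedAddCommGroup.toNorm.norm A

/-- `Y n = O_P(r n)`. For sets that are not measurable, `P` is the outer measure. -/
def IsBigOP {S : Type*} [MeasurableSpace S] (P : Measure S) (Y : ℕ → S → ℝ) (r : ℕ → ℝ) : Prop :=
  ∀ ε : ℝ, 0 < ε → ∃ M : ℝ, ∀ᶠ n in atTop, P {ω | M * r n < |Y n ω|} ≤ ENNReal.ofReal ε

/-- The events `E n` have probability tending to one, written as: the (outer) probability of the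
complement of `E n` tends to zero. -/
def WithProbToOne {S : Type*} [MeasurableSpace S] (P : Measure S) (E : ℕ → S → Prop) : Prop :=
  Tendsto (fun n => P {ω | ¬ E n ω}) atTop (𝓝 0)

/-- The `n × p` matrix of the first `n` observations. -/
def dataMatrix {p : ℕ} {S : Type*} (X : ℕ → S → EuclideanSpace ℝ (Fin p)) (n : ℕ) (ω : S) :
    Matrix (Fin n) (Fin p) ℝ :=
  fun k j => X k ω j

/-- `Uhat` is a sequence of local maximizers of the penalized log-likelihood over the DAG space,
given in the parametrization `U = R + Φ`, which estimates `(B₀, Ω₀)`, its support and `Θ₀`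
consistently, at the rate `n^{-1/2}`. -/
structure IsConsistentLocalMax {p : ℕ} {S : Type*} [MeasurableSpace S] (P : Measure S)
    (X : ℕ → S → EuclideanSpace ℝ (Fin p)) (pen : ℕ → ℝ → ℝ)
    (Th0 B0 Om0 : Matrix (Fin p) (Fin p) ℝ) (Uhat : ℕ → S → Matrix (Fin p) (Fin p) ℝ) : Prop where
  localMax : WithProbToOne P fun n ω => Uhat n ω ∈ dagSpace p ∧
    IsLocalMaxOn (penLogLik (pen n) (dataMatrix X n ω)) (dagSpace p) (Uhat n ω)
  rate : IsBigOP P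
    (fun n ω => frobNorm (toB (Uhat n ω) - B0) + frobNorm (toOmega (Uhat n ω) - Om0))
    (fun n => 1 / √(n : ℝ))
  support : WithProbToOne P fun n ω => matSupp (toB (Uhat n ω)) = matSupp B0
  rateTheta : IsBigOP P
    (fun n ω => frobNorm (thetaOf (toB (Uhat n ω)) (toOmega (Uhat n ω)) - Th0))
    (fun n => 1 / √(n : ℝ))

/-!
Write `S = Xᵀ X / n`, so that the penalized likelihood is `n` times
`avgObj q S U = ∑ log ρ_j - tr ((R - Φ)ᵀ S (R - Φ)) / 2 - ∑ q |φ_ij|`. The data enter only through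
`S`, and `S - Σ₀ = O_P(n^{-1/2})` entrywise by Chebyshev's inequality (`isBigOP_sampleCov_sub`);
apart from this, the argument is deterministic for each `S` within `K n^{-1/2}` of `Σ₀`. It rests on
one algebraic fact (`score_diag`, `score_eq_zero`): at a member `e` of the equivalence class the
matrix `Σ₀ (R - Φ) = (R - Φ)⁻ᵀ` has diagonal `1 / ρ` and vanishes at `(i, j)` unless `e` has a
directed path from `j` to `i`. Hence the population score is zero in every direction that keeps a
topological order of `e`.

*Existence.* On the coordinate subspace given by the support of `e`, the concave quadratic term of
the likelihood dominates the score and the change of the penalty on a sphere of radius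
`M n^{-1/2}`, for large `M` (`avgObj_lt_on_sphere`), so there is a maximizer inside the ball. It is a
local maximizer over all DAGs (`isLocalMaxOn_of_subspace`): a DAG near it contains the edges of `e`,
so its further edges admit no path backwards in `e`; the likelihood changes along them at rate
`O(n^{-1/2})` only, which is less than the slope of the penalty at zero, of order `λ_n`. The
estimator `nearestMax` selects such a local maximizer as a function of the data.

*Comparison.* The members of the equivalence class are exactly the pairs attached to permutations
(`exists_perm_eq_tilde`), so there are finitely many, and they share the value of
`avgLogLik Σ₀` (`avgLogLik_toU`). The penalty of an edge is `τ + O_P(n^{-1/2})`, by concavity. Thus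
the value of `avgObj` at a consistent local maximizer is a common constant minus
`τ · numEdges + O_P(n^{-1/2})` (`isBigOP_avgObj_sub`), and `τ n^{1/2} → ∞` makes the number of edges
decisive.
-/

/-! ### Calculus of stochastic order symbols for outer probabilities -/

section Probability

variable {S : Type*} [MeasurableSpace S] {P : Measure S}

/-- The transfer principle: a bound `|Y n| ≤ K r n` that forces `|Z n| ≤ M r n` carries `O_P`
from `Y` to `Z`. -/
lemma IsBigOP.transfer {Y Z : ℕ → S → ℝ} {r s : ℕ → ℝ} (hY : IsBigOP P Y r)
    (h : ∀ K : ℝ, ∃ M : ℝ, ∀ᶠ n in atTop, ∀ ω, |Y n ω| ≤ K * r n → |Z n ω| ≤ M * s n) :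
    IsBigOP P Z s := by
  intro ε hε
  obtain ⟨K, hK⟩ := hY ε hε
  obtain ⟨M, hM⟩ := h K
  refine ⟨M, ?_⟩
  filter_upwards [hK, hM] with n h1 h2
  refine (measure_mono fun ω hω => ?_).trans h1
  exact lt_of_not_ge fun hle => (lt_irrefl _ ((h2 ω hle).trans_lt' hω))

lemma IsBigOP.of_bound {Y : ℕ → S → ℝ} {r : ℕ → ℝ} (C : ℝ)
    (h : ∀ᶠ n in atTop, ∀ ω, |Y n ω| ≤ C * r n) : IsBigOP P Y r := by
  intro ε hε
  refine ⟨C, ?_⟩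
  filter_upwards [h] with n hn
  rw [show {ω | C * r n < |Y n ω|} = ∅ from Set.eq_empty_of_forall_notMem fun ω hω =>
    (hn ω).not_gt hω]
  simp

lemma IsBigOP.transfer₂ {Y Y' Z : ℕ → S → ℝ} {r : ℕ → ℝ} (hr : ∀ n, 0 ≤ r n)
    (hY : IsBigOP P Y r) (hY' : IsBigOP P Y' r)
    (h : ∀ K : ℝ, 0 < K → ∃ M : ℝ, ∀ᶠ n in atTop, ∀ ω, |Y n ω| ≤ K * r n → |Y' n ω| ≤ K * r n →
      |Z n ω| ≤ M * r n) : IsBigOP P Z r := by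
  intro ε hε
  obtain ⟨K, hK⟩ := hY (ε / 2) (by positivity)
  obtain ⟨K', hK'⟩ := hY' (ε / 2) (by positivity)
  obtain ⟨M, hM⟩ := h (max 1 (max K K')) (by positivity)
  refine ⟨M, ?_⟩
  filter_upwards [hK, hK', hM] with n h1 h2 h3
  calc P {ω | M * r n < |Z n ω|}
      ≤ P ({ω | K * r n < |Y n ω|} ∪ {ω | K' * r n < |Y' n ω|}) := by
        refine measure_mono fun ω hω => ?_
        by_contra hcon
        simp only [Set.mem_union, Set.mem_ofPred_eq, not_or, not_lt] at hcon
        refine (h3 ω (hcon.1.trans ?_) (hcon.2.trans ?_)).not_gt hω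
        · exact mul_le_mul_of_nonneg_right (by simp) (hr n)
        · exact mul_le_mul_of_nonneg_right (by simp) (hr n)
    _ ≤ ENNReal.ofReal (ε / 2) + ENNReal.ofReal (ε / 2) :=
        (measure_union_le _ _).trans (add_le_add h1 h2)
    _ = ENNReal.ofReal ε := by
        rw [← ENNReal.ofReal_add (by positivity) (by positivity)]; congr 1; ring

lemma IsBigOP.add {Y Z : ℕ → S → ℝ} {r : ℕ → ℝ} (hr : ∀ n, 0 ≤ r n)
    (hY : IsBigOP P Y r) (hZ : IsBigOP P Z r) : IsBigOP P (fun n ω => Y n ω + Z n ω) r :=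
  hY.transfer₂ hr hZ fun K _ => ⟨K + K, Eventually.of_forall fun n ω h1 h2 =>
    (abs_add_le _ _).trans ((add_le_add h1 h2).trans_eq (by ring))⟩

lemma IsBigOP.sub {Y Z : ℕ → S → ℝ} {r : ℕ → ℝ} (hr : ∀ n, 0 ≤ r n)
    (hY : IsBigOP P Y r) (hZ : IsBigOP P Z r) : IsBigOP P (fun n ω => Y n ω - Z n ω) r :=
  hY.transfer₂ hr hZ fun K _ => ⟨K + K, Eventually.of_forall fun n ω h1 h2 =>
    (abs_sub _ _).trans ((add_le_add h1 h2).trans_eq (by ring))⟩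

lemma IsBigOP.sum {ι : Type*} (s : Finset ι) {Y : ι → ℕ → S → ℝ} {r : ℕ → ℝ}
    (hr : ∀ n, 0 ≤ r n) (hY : ∀ i ∈ s, IsBigOP P (Y i) r) :
    IsBigOP P (fun n ω => ∑ i ∈ s, Y i n ω) r := by
  classical
  induction s using Finset.induction_on with
  | empty => exact .of_bound 0 (by simp)
  | insert a s ha ih =>
    simp only [Finset.sum_insert ha]
    exact (hY a (by simp)).add hr (ih fun i hi => hY i (by simp [hi]))

lemma IsBigOP.const_mul {Y : ℕ → S → ℝ} {r : ℕ → ℝ} (c : ℝ)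
    (hY : IsBigOP P Y r) : IsBigOP P (fun n ω => c * Y n ω) r :=
  hY.transfer fun K => ⟨|c| * K, Eventually.of_forall fun n ω h => by
    rw [abs_mul, mul_assoc]; exact mul_le_mul_of_nonneg_left h (abs_nonneg c)⟩

lemma IsBigOP.mono {Y Z : ℕ → S → ℝ} {r : ℕ → ℝ} (hY : IsBigOP P Y r)
    (h : ∀ n ω, |Z n ω| ≤ |Y n ω|) : IsBigOP P Z r :=
  hY.transfer fun K => ⟨K, Eventually.of_forall fun n ω hK => (h n ω).trans hK⟩

lemma IsBigOP.abs {Y : ℕ → S → ℝ} {r : ℕ → ℝ} (hY : IsBigOP P Y r) :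
    IsBigOP P (fun n ω => |Y n ω|) r :=
  hY.mono fun _ _ => (abs_abs _).le

lemma withProbToOne_iff {E : ℕ → S → Prop} : WithProbToOne P E ↔
    ∀ ε : ℝ, 0 < ε → ∀ᶠ n in atTop, P {ω | ¬ E n ω} ≤ ENNReal.ofReal ε := by
  rw [WithProbToOne, ENNReal.tendsto_nhds_zero]
  constructor
  · intro h ε hε
    exact h _ (ENNReal.ofReal_pos.2 hε)
  · intro h ε hε
    rcases eq_or_ne ε ⊤ with rfl | hne
    · simp
    · have := h ε.toReal (ENNReal.toReal_pos hε.ne' hne)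
      rwa [ENNReal.ofReal_toReal hne] at this

lemma WithProbToOne.mono {E E' : ℕ → S → Prop} (h : WithProbToOne P E)
    (hE : ∀ᶠ n in atTop, ∀ ω, E n ω → E' n ω) : WithProbToOne P E' := by
  rw [withProbToOne_iff] at h ⊢
  intro ε hε
  filter_upwards [h ε hε, hE] with n h1 h2
  refine (measure_mono fun ω hω => ?_).trans h1
  exact fun hE => hω (h2 ω hE)

lemma WithProbToOne.and {E E' : ℕ → S → Prop} (h : WithProbToOne P E)
    (h' : WithProbToOne P E') : WithProbToOne P fun n ω => E n ω ∧ E' n ω := by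
  rw [withProbToOne_iff] at h h' ⊢
  intro ε hε
  filter_upwards [h (ε / 2) (by positivity), h' (ε / 2) (by positivity)] with n h1 h2
  calc P {ω | ¬ (E n ω ∧ E' n ω)}
      ≤ P ({ω | ¬ E n ω} ∪ {ω | ¬ E' n ω}) := measure_mono fun ω hω => by
        simp only [Set.mem_union, Set.mem_ofPred_eq] at hω ⊢; tauto
    _ ≤ ENNReal.ofReal (ε / 2) + ENNReal.ofReal (ε / 2) :=
        (measure_union_le _ _).trans (add_le_add h1 h2)
    _ = ENNReal.ofReal ε := by
        rw [← ENNReal.ofReal_add (by positivity) (by positivity)]; congr 1; ring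

lemma withProbToOne_of_forall {E : ℕ → S → Prop} (h : ∀ᶠ n in atTop, ∀ ω, E n ω) :
    WithProbToOne P E := by
  rw [withProbToOne_iff]
  intro ε hε
  filter_upwards [h] with n hn
  simp [hn]

lemma withProbToOne_forall_finite {ι : Type*} {s : Set ι} (hs : s.Finite) {E : ι → ℕ → S → Prop}
    (h : ∀ i ∈ s, WithProbToOne P (E i)) : WithProbToOne P fun n ω => ∀ i ∈ s, E i n ω := by
  induction s, hs using Set.Finite.induction_on with
  | empty => exact withProbToOne_of_forall (by simp)
  | @insert a s ha hs ih =>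
    refine ((h a (by simp)).and (ih fun i hi => h i (by simp [hi]))).mono
      (Eventually.of_forall fun n ω hE i hi => ?_)
    rcases hi with rfl | hi
    · exact hE.1
    · exact hE.2 i hi

/-- An event that holds, for large `n`, whenever `|Y n| ≤ K r n` has probability tending to one
if `Y = O_P(r)`. -/
lemma IsBigOP.withProbToOne {Y : ℕ → S → ℝ} {r : ℕ → ℝ} (hY : IsBigOP P Y r) {E : ℕ → S → Prop}
    (h : ∀ K : ℝ, ∀ᶠ n in atTop, ∀ ω, |Y n ω| ≤ K * r n → E n ω) : WithProbToOne P E := by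
  rw [withProbToOne_iff]
  intro ε hε
  obtain ⟨K, hK⟩ := hY ε hε
  filter_upwards [hK, h K] with n h1 h2
  refine (measure_mono fun ω hω => ?_).trans h1
  exact lt_of_not_ge fun hle => hω (h2 ω hle)

/-- `O_P` is unaffected by what happens outside events of probability tending to one. -/
lemma IsBigOP.of_withProbToOne {Y Z : ℕ → S → ℝ} {r : ℕ → ℝ} (hY : IsBigOP P Y r)
    (h : WithProbToOne P fun n ω => |Z n ω| ≤ |Y n ω|) : IsBigOP P Z r := by
  intro ε hε
  rw [withProbToOne_iff] at h
  obtain ⟨K, hK⟩ := hY (ε / 2) (by positivity)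
  refine ⟨K, ?_⟩
  filter_upwards [hK, h (ε / 2) (by positivity)] with n h1 h2
  calc P {ω | K * r n < |Z n ω|}
      ≤ P ({ω | K * r n < |Y n ω|} ∪ {ω | ¬ |Z n ω| ≤ |Y n ω|}) := by
        refine measure_mono fun ω hω => ?_
        by_contra hcon
        simp only [Set.mem_union, Set.mem_ofPred_eq, not_or, not_lt, not_not] at hcon hω
        linarith
    _ ≤ ENNReal.ofReal (ε / 2) + ENNReal.ofReal (ε / 2) :=
        (measure_union_le _ _).trans (add_le_add h1 h2)
    _ = ENNReal.ofReal ε := by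
        rw [← ENNReal.ofReal_add (by positivity) (by positivity)]; congr 1; ring

/-- The delta method for a function of two variables. -/
lemma IsBigOP.delta {Y Z : ℕ → S → ℝ} {r : ℕ → ℝ} (hr : ∀ n, 0 ≤ r n)
    (hr0 : Tendsto r atTop (𝓝 0)) {y z : ℝ} (f : ℝ × ℝ → ℝ) (hf : DifferentiableAt ℝ f (y, z))
    (hY : IsBigOP P (fun n ω => Y n ω - y) r) (hZ : IsBigOP P (fun n ω => Z n ω - z) r) :
    IsBigOP P (fun n ω => f (Y n ω, Z n ω) - f (y, z)) r := by
  obtain ⟨C, hC⟩ := hf.isBigO_sub.bound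
  obtain ⟨δ, hδ, hball⟩ := Metric.eventually_nhds_iff.1 hC
  refine hY.transfer₂ hr hZ fun K hK => ⟨|C| * K, ?_⟩
  have h0 : Tendsto (fun n => K * r n) atTop (𝓝 0) := by simpa using hr0.const_mul K
  filter_upwards [h0.eventually_lt_const hδ] with n hn ω h1 h2
  have hd : ‖((Y n ω, Z n ω) : ℝ × ℝ) - (y, z)‖ ≤ K * r n := by
    rw [Prod.mk_sub_mk, Prod.norm_def]
    exact max_le h1 h2
  have := hball (y := (Y n ω, Z n ω)) (by rw [dist_eq_norm]; exact hd.trans_lt hn)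
  rw [Real.norm_eq_abs] at this
  calc |f (Y n ω, Z n ω) - f (y, z)| ≤ C * ‖((Y n ω, Z n ω) : ℝ × ℝ) - (y, z)‖ := this
    _ ≤ |C| * (K * r n) := mul_le_mul (le_abs_self C) hd (norm_nonneg _) (abs_nonneg _)
    _ = |C| * K * r n := by ring

lemma IsBigOP.mul_sub {Y Z : ℕ → S → ℝ} {r : ℕ → ℝ} (hr : ∀ n, 0 ≤ r n)
    (hr0 : Tendsto r atTop (𝓝 0)) {y z : ℝ}
    (hY : IsBigOP P (fun n ω => Y n ω - y) r) (hZ : IsBigOP P (fun n ω => Z n ω - z) r) :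
    IsBigOP P (fun n ω => Y n ω * Z n ω - y * z) r :=
  IsBigOP.delta hr hr0 (fun x => x.1 * x.2) (by fun_prop) hY hZ

lemma IsBigOP.sum_sub {ι : Type*} (s : Finset ι) {Y : ι → ℕ → S → ℝ} {y : ι → ℝ} {r : ℕ → ℝ}
    (hr : ∀ n, 0 ≤ r n) (hY : ∀ i ∈ s, IsBigOP P (fun n ω => Y i n ω - y i) r) :
    IsBigOP P (fun n ω => ∑ i ∈ s, Y i n ω - ∑ i ∈ s, y i) r := by
  simpa only [Finset.sum_sub_distrib] using IsBigOP.sum s hr hY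

end Probability

lemma rate_nonneg (n : ℕ) : (0 : ℝ) ≤ 1 / √(n : ℝ) := by positivity

lemma tendsto_rate : Tendsto (fun n : ℕ => 1 / √(n : ℝ)) atTop (𝓝 0) := by
  simp only [one_div]
  exact tendsto_inv_atTop_zero.comp (Real.tendsto_sqrt_atTop.comp tendsto_natCast_atTop_atTop)

/-! ### The sample covariance matrix -/

/-- The matrix `Xᵀ X / n` of uncentred second sample moments. -/
noncomputable def sampleCov {n p : ℕ} (X : Matrix (Fin n) (Fin p) ℝ) : Matrix (Fin p) (Fin p) ℝ :=
  (n : ℝ)⁻¹ • (Xᵀ * X)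

lemma sampleCov_apply {n p : ℕ} (X : Matrix (Fin n) (Fin p) ℝ) (i j : Fin p) :
    sampleCov X i j = (n : ℝ)⁻¹ * ∑ k, X k i * X k j := by
  simp [sampleCov, Matrix.mul_apply]

lemma sampleCov_symm {n p : ℕ} (X : Matrix (Fin n) (Fin p) ℝ) (i j : Fin p) :
    sampleCov X i j = sampleCov X j i := by
  simp only [sampleCov_apply, mul_comm]

section SampleMoments

variable {p : ℕ} {Sigma0 : Matrix (Fin p) (Fin p) ℝ}

lemma memLp_coord_mul_coord (i j : Fin p) :
    MemLp (fun x : EuclideanSpace ℝ (Fin p) => x i * x j) 2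
      (multivariateGaussian 0 Sigma0) := by
  have h4 (i : Fin p) : MemLp (fun x : EuclideanSpace ℝ (Fin p) => x i) 4
      (multivariateGaussian 0 Sigma0) := by
    have := (IsGaussian.memLp_id (multivariateGaussian 0 Sigma0) 4 (by norm_num))
    exact (EuclideanSpace.proj (𝕜 := ℝ) i).comp_memLp' this
  have : ENNReal.HolderTriple 4 4 2 := ⟨by
    rw [show (4 : ENNReal) = 2 * 2 by norm_num, ENNReal.mul_inv (by simp) (by simp), ← mul_add,
      ENNReal.inv_two_add_inv_two, mul_one]⟩
  exact (h4 j).mul (h4 i)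

lemma integral_coord_mul_coord (hS : Sigma0.PosSemidef) (i j : Fin p) :
    ∫ x : EuclideanSpace ℝ (Fin p), x i * x j ∂(multivariateGaussian 0 Sigma0) = Sigma0 i j := by
  have hint (i : Fin p) : ∫ x : EuclideanSpace ℝ (Fin p), x i
      ∂(multivariateGaussian 0 Sigma0) = 0 := by
    have := (EuclideanSpace.proj (𝕜 := ℝ) i).integral_comp_comm
      (IsGaussian.integrable_fun_id (μ := multivariateGaussian 0 Sigma0))
    simpa using this
  have := covariance_eval_multivariateGaussian (μ := 0) hS i j
  rw [covariance] at this
  simpa [hint] using this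

/-- Chebyshev's inequality for one entry of the sample covariance matrix. -/
lemma isBigOP_sampleCov_sub {S : Type*} [MeasurableSpace S] {P : Measure S}
    [IsProbabilityMeasure P] {X : ℕ → S → EuclideanSpace ℝ (Fin p)} (hS : Sigma0.PosSemidef)
    (hindep : iIndepFun X P) (hlaw : ∀ k, HasLaw (X k) (multivariateGaussian 0 Sigma0) P)
    (i j : Fin p) :
    IsBigOP P (fun n ω => sampleCov (dataMatrix X n ω) i j - Sigma0 i j)
      (fun n => 1 / √(n : ℝ)) := by
  set g : EuclideanSpace ℝ (Fin p) → ℝ := fun x => x i * x j with hg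
  have hgm : Measurable g := by fun_prop
  set Y : ℕ → S → ℝ := fun k ω => g (X k ω) with hY
  have hmem (k : ℕ) : MemLp (Y k) 2 P := by
    have h := memLp_coord_mul_coord (Sigma0 := Sigma0) i j
    rw [← (hlaw k).map_eq] at h
    exact h.comp_of_map (hlaw k).aemeasurable
  have hmean (k : ℕ) : ∫ ω, Y k ω ∂P = Sigma0 i j := by
    rw [← integral_coord_mul_coord hS i j]
    exact (hlaw k).integral_comp hgm.aestronglyMeasurable
  set v : ℝ := Var[g; multivariateGaussian 0 Sigma0] with hv
  have hvar (k : ℕ) : Var[Y k; P] = v := by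
    rw [hv, ← (hlaw k).map_eq, variance_map hgm.aemeasurable (hlaw k).aemeasurable]
    rfl
  have hv0 : 0 ≤ v := variance_nonneg _ _
  intro ε hε
  -- The summand `1` keeps the threshold in Chebyshev's inequality positive when `v = 0`.
  refine ⟨√(v / ε) + 1, ?_⟩
  filter_upwards [eventually_gt_atTop 0] with n hn
  have hn' : (0 : ℝ) < n := by exact_mod_cast hn
  set T : S → ℝ := fun ω => ∑ k ∈ Finset.range n, Y k ω with hT
  have hTmem : MemLp T 2 P := memLp_finsetSum _ fun k _ => hmem k
  have hTmean : ∫ ω, T ω ∂P = n * Sigma0 i j := by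
    rw [hT, integral_finsetSum _ fun k _ => (hmem k).integrable one_le_two]
    simp [hmean]
  have hTvar : Var[T; P] = n * v := by
    have : T = ∑ k ∈ Finset.range n, Y k := by ext ω; simp [hT]
    rw [this, IndepFun.variance_sum (fun k _ => hmem k)]
    · simp [hvar]
    · intro a _ b _ hab
      exact (hindep.indepFun hab).comp hgm hgm
  set c : ℝ := √n * (√(v / ε) + 1) with hc
  have hc0 : 0 < c := by positivity
  have hcheb := meas_ge_le_variance_div_sq hTmem hc0
  rw [hTvar, hTmean] at hcheb
  refine (measure_mono fun ω hω => ?_).trans (hcheb.trans (ENNReal.ofReal_le_ofReal ?_))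
  · have hω' : (√(v / ε) + 1) * (1 / √(n : ℝ))
        < |sampleCov (dataMatrix X n ω) i j - Sigma0 i j| := hω
    have hs : sampleCov (dataMatrix X n ω) i j - Sigma0 i j
        = (n : ℝ)⁻¹ * (T ω - n * Sigma0 i j) := by
      rw [sampleCov_apply, mul_sub, inv_mul_cancel_left₀ hn'.ne', hT]
      simp only [hY, hg, dataMatrix]
      rw [Finset.sum_range]
    rw [hs, abs_mul, abs_of_pos (inv_pos.2 hn')] at hω'
    change c ≤ |T ω - n * Sigma0 i j|
    have h2 := mul_lt_mul_of_pos_left hω' hn'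
    rw [mul_inv_cancel_left₀ hn'.ne'] at h2
    refine le_of_eq_of_le ?_ h2.le
    rw [hc]
    have : √(n : ℝ) * √n = n := Real.mul_self_sqrt hn'.le
    have h0 : 0 < √(n : ℝ) := Real.sqrt_pos.2 hn'
    field_simp
    nlinarith
  · rw [hc, mul_pow, Real.sq_sqrt hn'.le, mul_div_mul_left _ _ hn'.ne']
    have h1 : v / ε ≤ (√(v / ε) + 1) ^ 2 := by
      have := Real.sq_sqrt (div_nonneg hv0 hε.le)
      nlinarith [Real.sqrt_nonneg (v / ε)]
    rw [div_le_iff₀ (by positivity)]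
    rw [div_le_iff₀ hε] at h1
    linarith

end SampleMoments

/-! ### Topological orders and the equivalence class -/

section DAG

/-- Every partial order on a finite type has a linear extension, here given by an enumeration. -/
lemma exists_equiv_fin {α : Type*} [Fintype α] (r : α → α → Prop) [IsPartialOrder α r] {k : ℕ}
    (hk : Fintype.card α = k) : ∃ e : Fin k ≃ α, ∀ i j, i ≤ j → r (e j) (e i) → e i = e j := by
  obtain ⟨s, hs, hrs⟩ := extend_partialOrder r
  classical
  let lo : LinearOrder α :=
    { le := s
      le_refl := hs.refl
      le_trans := hs.trans
      le_antisymm := hs.antisymm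
      le_total := hs.total
      toDecidableLE := Classical.decRel _ }
  let e := monoEquivOfFin α hk
  exact ⟨e.toEquiv, fun i j hij h => hs.antisymm _ _ (e.monotone hij) (hrs _ _ h)⟩

variable {p : ℕ}

lemma IsDAG.mono {B B' : Matrix (Fin p) (Fin p) ℝ} (h : IsDAG B')
    (hB : ∀ i j, B i j ≠ 0 → B' i j ≠ 0) : IsDAG B :=
  fun i hi => h i (Relation.TransGen.mono hB _ _ hi)

lemma IsDAG.apply_self {B : Matrix (Fin p) (Fin p) ℝ} (h : IsDAG B) (i : Fin p) : B i i = 0 := by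
  by_contra hne
  exact h i (.single hne)

lemma IsStrictLower.isDAG {L : Matrix (Fin p) (Fin p) ℝ} (hL : IsStrictLower L) : IsDAG L := by
  have key : ∀ i j, Relation.TransGen (fun a b => L a b ≠ 0) i j → j < i := by
    intro i j h
    induction h with
    | single h => exact lt_of_not_ge fun hle => h (hL _ _ hle)
    | tail _ h ih => exact (lt_of_not_ge fun hle => h (hL _ _ hle)).trans ih
  exact fun i hi => lt_irrefl _ (key i i hi)

/-- Topological sorting: a DAG is strictly lower triangular in a suitable order. -/
lemma IsDAG.exists_perm {B : Matrix (Fin p) (Fin p) ℝ} (h : IsDAG B) :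
    ∃ π : Equiv.Perm (Fin p), IsStrictLower (permMat π B) := by
  let r : Fin p → Fin p → Prop := fun a b => Relation.ReflTransGen (fun a b => B b a ≠ 0) a b
  have hr : IsPartialOrder (Fin p) r :=
    { refl := fun a => .refl
      trans := fun a b c => .trans
      antisymm := fun a b hab hba => by
        by_contra hne
        have h1 : Relation.TransGen (fun a b => B b a ≠ 0) a b :=
          (Relation.reflTransGen_iff_eq_or_transGen.1 hab).resolve_left (Ne.symm hne)
        have h2 := h1.trans_left hba
        rw [← Relation.transGen_swap] at h2
        exact h a h2 }
  obtain ⟨e, he⟩ := exists_equiv_fin r (Fintype.card_fin p)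
  refine ⟨e, fun i j hij => ?_⟩
  by_contra hne
  have h3 : e i = e j := he i j hij (.single hne)
  have h4 : B (e i) (e i) ≠ 0 := by
    have : B (e i) (e j) ≠ 0 := hne
    rwa [← h3] at this
  exact h4 (h.apply_self _)

lemma IsVarianceMatrix.permMat {Om : Matrix (Fin p) (Fin p) ℝ} (h : IsVarianceMatrix Om)
    (π : Equiv.Perm (Fin p)) : IsVarianceMatrix (permMat π Om) := by
  obtain ⟨d, hd, rfl⟩ := h
  refine ⟨d ∘ π, fun j => hd _, ?_⟩
  ext i j
  simp [_root_.permMat, Matrix.diagonal_apply]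

lemma permMat_thetaOf (B Om : Matrix (Fin p) (Fin p) ℝ) (π : Equiv.Perm (Fin p)) :
    permMat π (thetaOf B Om) = thetaOf (permMat π B) (permMat π Om) := by
  have h1 : (1 : Matrix (Fin p) (Fin p) ℝ) - B.submatrix π π = (1 - B).submatrix π π := by
    ext i j; simp [Matrix.one_apply]
  simp only [permMat, thetaOf, Matrix.inv_submatrix_equiv, h1, Matrix.transpose_submatrix,
    Matrix.submatrix_mul_equiv]

lemma permMat_inv_permMat (A : Matrix (Fin p) (Fin p) ℝ) (π : Equiv.Perm (Fin p)) :
    permMat π⁻¹ (permMat π A) = A := by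
  ext i j; simp [permMat]

lemma IsDAG.permMat {B : Matrix (Fin p) (Fin p) ℝ} (h : IsDAG B) (π : Equiv.Perm (Fin p)) :
    IsDAG (_root_.permMat π B) := by
  intro i hi
  exact h (π i) (hi.lift π fun _ _ hab => hab)

lemma tilde_mem_equivClass {Th : Matrix (Fin p) (Fin p) ℝ} (hTh : Th.PosDef)
    (π : Equiv.Perm (Fin p)) : (Btilde Th π, OmegaTilde Th π) ∈ equivClass Th := by
  obtain ⟨h1, h2, h3⟩ := choleskyPair_spec (A := permMat π Th) (hTh.submatrix π.injective)
  refine ⟨h1.isDAG.permMat _, h2.permMat _, ?_⟩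
  change thetaOf (permMat π⁻¹ _) (permMat π⁻¹ _) = Th
  rw [← permMat_thetaOf, ← h3, permMat_inv_permMat]

lemma exists_perm_eq_tilde {Th : Matrix (Fin p) (Fin p) ℝ} (hTh : Th.PosDef)
    {e : Matrix (Fin p) (Fin p) ℝ × Matrix (Fin p) (Fin p) ℝ} (he : e ∈ equivClass Th) :
    ∃ π : Equiv.Perm (Fin p), e = (Btilde Th π, OmegaTilde Th π) := by
  obtain ⟨h1, h2, h3⟩ := he
  obtain ⟨π, hπ⟩ := h1.exists_perm
  refine ⟨π, ?_⟩
  have hc : IsCholesky (permMat π Th) (permMat π e.1) (permMat π e.2) :=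
    ⟨hπ, h2.permMat π, by rw [← h3, permMat_thetaOf]⟩
  obtain ⟨e1, e2⟩ := hc.unique (choleskyPair_spec (hTh.submatrix π.injective))
  ext1
  · rw [Btilde, ← e1, permMat_inv_permMat]
  · rw [OmegaTilde, ← e2, permMat_inv_permMat]

lemma equivClass_finite {Th : Matrix (Fin p) (Fin p) ℝ} (hTh : Th.PosDef) :
    (equivClass Th).Finite :=
  (Set.finite_range fun π : Equiv.Perm (Fin p) => (Btilde Th π, OmegaTilde Th π)).subset
    fun _ he => (exists_perm_eq_tilde hTh he).imp fun _ h => h.symm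

lemma IsDAG.det_one_sub {B : Matrix (Fin p) (Fin p) ℝ} (h : IsDAG B) : (1 - B).det = 1 := by
  obtain ⟨π, hπ⟩ := h.exists_perm
  have h1 : (1 - B).submatrix π π = 1 - _root_.permMat π B := by
    ext i j; simp [Matrix.one_apply, _root_.permMat]
  rw [← Matrix.det_submatrix_equiv_self π, h1, Matrix.det_of_isLowerTriangular]
  · exact Finset.prod_eq_one fun i _ => by simp [hπ i i le_rfl]
  · intro i j hij
    have hlt : i < j := hij
    simp [hlt.ne, hπ i j hlt.le]

/-! ### The residual matrix `R - Φ` -/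

/-- The matrix `R - Φ` of `U = R + Φ`, so that `Θ = (R - Φ) (R - Φ)ᵀ`. -/
def resid (U : Matrix (Fin p) (Fin p) ℝ) : Matrix (Fin p) (Fin p) ℝ :=
  fun i j => if i = j then U i j else -U i j

lemma resid_self (U : Matrix (Fin p) (Fin p) ℝ) (j : Fin p) : resid U j j = U j j := by
  simp [resid]

lemma resid_of_ne (U : Matrix (Fin p) (Fin p) ℝ) {i j : Fin p} (h : i ≠ j) :
    resid U i j = -U i j := by
  simp [resid, h]

lemma abs_resid (U : Matrix (Fin p) (Fin p) ℝ) (i j : Fin p) : |resid U i j| = |U i j| := by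
  by_cases h : i = j <;> simp [resid, h]

lemma resid_sq (U : Matrix (Fin p) (Fin p) ℝ) (i j : Fin p) : resid U i j ^ 2 = U i j ^ 2 := by
  rw [← sq_abs, abs_resid, sq_abs]

lemma resid_add (U V : Matrix (Fin p) (Fin p) ℝ) : resid (U + V) = resid U + resid V := by
  ext i j
  by_cases h : i = j <;> simp [resid, h]
  ring

lemma toU_diag_pos {e : Matrix (Fin p) (Fin p) ℝ × Matrix (Fin p) (Fin p) ℝ}
    (h : IsVarianceMatrix e.2) (j : Fin p) : 0 < toU e j j := by
  obtain ⟨d, hd, he⟩ := h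
  have := hd j
  simp only [toU, if_true, he, Matrix.diagonal_apply_eq]
  positivity

lemma toU_ne_zero_iff {e : Matrix (Fin p) (Fin p) ℝ × Matrix (Fin p) (Fin p) ℝ}
    (h : IsVarianceMatrix e.2) {i j : Fin p} (hij : i ≠ j) : toU e i j ≠ 0 ↔ e.1 i j ≠ 0 := by
  obtain ⟨d, hd, he⟩ := h
  have := (Real.sqrt_pos.2 (hd j)).ne'
  simp [toU, hij, he, this]

lemma toU_toB_toOmega {U : Matrix (Fin p) (Fin p) ℝ} (hU : ∀ j, 0 < U j j) :
    toU (toB U, toOmega U) = U := by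
  ext i j
  have h := hU j
  have hs : √(1 / U j j ^ 2) = 1 / U j j := by
    rw [Real.sqrt_div zero_le_one, Real.sqrt_one, Real.sqrt_sq h.le]
  by_cases hij : i = j
  · subst hij
    simp only [toU, if_true, toOmega, Matrix.diagonal_apply_eq, hs, one_div_one_div]
  · simp only [toU, hij, if_false, toOmega, toB, Matrix.diagonal_apply_eq, hs]
    field_simp

lemma toB_toU {e : Matrix (Fin p) (Fin p) ℝ × Matrix (Fin p) (Fin p) ℝ} (h1 : IsDAG e.1)
    (h2 : IsVarianceMatrix e.2) : toB (toU e) = e.1 := by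
  obtain ⟨d, hd, he⟩ := h2
  ext i j
  have := (Real.sqrt_pos.2 (hd j)).ne'
  by_cases hij : i = j
  · subst hij; simp [toB, h1.apply_self]
  · simp only [toB, toU, hij, if_false, if_true, he, Matrix.diagonal_apply_eq]
    field_simp

lemma toOmega_toU {e : Matrix (Fin p) (Fin p) ℝ × Matrix (Fin p) (Fin p) ℝ}
    (h2 : IsVarianceMatrix e.2) : toOmega (toU e) = e.2 := by
  obtain ⟨d, hd, he⟩ := h2
  rw [he]
  refine congrArg Matrix.diagonal (funext fun j => ?_)
  simp only [toU, if_true, he, Matrix.diagonal_apply_eq, one_div, inv_pow, inv_inv]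
  exact Real.sq_sqrt (hd j).le

lemma resid_eq_mul {U : Matrix (Fin p) (Fin p) ℝ} (hU : ∀ j, 0 < U j j) :
    resid U = (1 - toB U) * Matrix.diagonal fun j => U j j := by
  ext i j
  rw [Matrix.mul_diagonal]
  have := (hU j).ne'
  by_cases hij : i = j
  · subst hij; simp [resid, toB]
  · simp only [resid, hij, if_false, Matrix.sub_apply, Matrix.one_apply, toB]
    field_simp
    ring

lemma resid_mul_transpose {U : Matrix (Fin p) (Fin p) ℝ} (hU : ∀ j, 0 < U j j) :
    resid U * (resid U)ᵀ = thetaOf (toB U) (toOmega U) := by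
  have h : (toOmega U)⁻¹ = Matrix.diagonal (fun j => U j j) * Matrix.diagonal (fun j => U j j) := by
    rw [toOmega, inv_diagonal_pos (fun j => by have := hU j; positivity),
      Matrix.diagonal_mul_diagonal]
    congr 1; funext j
    rw [one_div, inv_inv, sq]
  rw [thetaOf, h, resid_eq_mul hU, Matrix.transpose_mul, Matrix.diagonal_transpose]
  simp only [Matrix.mul_assoc]

lemma resid_toU_mul_transpose {Th : Matrix (Fin p) (Fin p) ℝ}
    {e : Matrix (Fin p) (Fin p) ℝ × Matrix (Fin p) (Fin p) ℝ} (he : e ∈ equivClass Th) :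
    resid (toU e) * (resid (toU e))ᵀ = Th := by
  rw [resid_mul_transpose (toU_diag_pos he.2.1), toB_toU he.1 he.2.1, toOmega_toU he.2.1, he.2.2]

/-- The log-determinant part of the likelihood is the same at all members of the equivalence
class. -/
lemma sum_log_toU {Th : Matrix (Fin p) (Fin p) ℝ}
    {e : Matrix (Fin p) (Fin p) ℝ × Matrix (Fin p) (Fin p) ℝ} (he : e ∈ equivClass Th) :
    ∑ j, Real.log (toU e j j) = Real.log Th.det / 2 := by
  have hpos := toU_diag_pos he.2.1
  have h : (∏ j, toU e j j) ^ 2 = Th.det := by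
    rw [← resid_toU_mul_transpose he, Matrix.det_mul, Matrix.det_transpose, resid_eq_mul hpos,
      Matrix.det_mul, toB_toU he.1 he.2.1, he.1.det_one_sub, Matrix.det_diagonal]
    ring
  rw [← h, Real.log_pow, Real.log_prod fun j _ => (hpos j).ne']
  push_cast; ring

section Score

variable {Sigma0 : Matrix (Fin p) (Fin p) ℝ}
  {e : Matrix (Fin p) (Fin p) ℝ × Matrix (Fin p) (Fin p) ℝ}

lemma mul_resid_transpose_mul_resid (hS : IsUnit Sigma0.det) (he : e ∈ equivClass Sigma0⁻¹) :
    resid (toU e) * (Sigma0 * resid (toU e))ᵀ = 1 := by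
  have h0 : Sigma0 * resid (toU e) * (resid (toU e))ᵀ = 1 := by
    rw [Matrix.mul_assoc, resid_toU_mul_transpose he, Matrix.mul_nonsing_inv _ hS]
  have h1 := congrArg Matrix.transpose h0
  rwa [Matrix.transpose_mul, Matrix.transpose_transpose, Matrix.transpose_one] at h1

/-- The population score: `Σ₀ (R - Φ)` has the diagonal `1 / ρ` and vanishes at `(i, j)` unless
there is a directed path from `j` to `i`. -/
lemma rho_mul_score (hS : IsUnit Sigma0.det) (he : e ∈ equivClass Sigma0⁻¹) (i j : Fin p)
    (hpath : ¬ Relation.TransGen (fun a b => e.1 a b ≠ 0) j i) :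
    toU e j j * (Sigma0 * resid (toU e)) i j = if i = j then 1 else 0 := by
  have hpos := toU_diag_pos he.2.1
  -- With `Y j = ρ_j Z i j`, the identity `(I - B) R Zᵀ = I` reads `Y j = δ_ij + ∑ k, B j k Y k`,
  -- which is solved by recursion along the edges.
  obtain ⟨Z, hZ⟩ : ∃ Z, Z = Sigma0 * resid (toU e) := ⟨_, rfl⟩
  rw [← hZ]
  have hrec : ∀ j, toU e j j * Z i j
      = (if i = j then 1 else 0) + ∑ k, e.1 j k * (toU e k k * Z i k) := by
    intro j
    have h1 := congrFun (congrFun (mul_resid_transpose_mul_resid hS he) j) i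
    rw [← hZ, resid_eq_mul hpos, toB_toU he.1 he.2.1, Matrix.mul_assoc, Matrix.sub_mul,
      Matrix.one_mul,
      Matrix.sub_apply, Matrix.diagonal_mul, Matrix.mul_apply, Matrix.one_apply] at h1
    simp only [Matrix.diagonal_mul, Matrix.transpose_apply] at h1
    simp only [eq_comm (a := i) (b := j)]
    linarith
  have : IsStrictOrder (Fin p) (fun a b => Relation.TransGen (fun a b => e.1 a b ≠ 0) b a) :=
    { irrefl := fun a h => he.1 a h
      trans := fun a b c h1 h2 => h2.trans h1 }
  have wf : WellFounded (fun a b : Fin p => Relation.TransGen (fun a b => e.1 a b ≠ 0) b a) :=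
    Finite.wellFounded_of_trans_of_irrefl _
  induction j using wf.induction with
  | _ j ih =>
    rw [hrec j, Finset.sum_eq_zero, add_zero]
    intro k _
    by_cases hk : e.1 j k = 0
    · rw [hk, zero_mul]
    have hki : ¬ Relation.TransGen (fun a b => e.1 a b ≠ 0) k i := fun h => hpath (.head hk h)
    rw [ih k (.single hk) hki, if_neg, mul_zero]
    rintro rfl
    exact hpath (.single hk)

lemma score_diag (hS : IsUnit Sigma0.det) (he : e ∈ equivClass Sigma0⁻¹) (j : Fin p) :
    (Sigma0 * resid (toU e)) j j = 1 / toU e j j := by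
  have := rho_mul_score hS he j j (he.1 j)
  rw [if_pos rfl] at this
  rw [eq_div_iff (toU_diag_pos he.2.1 j).ne', mul_comm, this]

lemma score_eq_zero (hS : IsUnit Sigma0.det) (he : e ∈ equivClass Sigma0⁻¹) {i j : Fin p}
    (hij : i ≠ j) (hpath : ¬ Relation.TransGen (fun a b => e.1 a b ≠ 0) j i) :
    (Sigma0 * resid (toU e)) i j = 0 := by
  have := rho_mul_score hS he i j hpath
  rw [if_neg hij] at this
  exact (mul_eq_zero.1 this).resolve_left (toU_diag_pos he.2.1 j).ne'

end Score

end DAG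

/-! ### The objective as a function of the sample covariance matrix -/

section Objective

variable {p : ℕ}

/-- The bilinear form `tr (Vᵀ S W)`. -/
def quad (S V W : Matrix (Fin p) (Fin p) ℝ) : ℝ := (Vᵀ * (S * W)).trace

lemma quad_eq_sum (S V W : Matrix (Fin p) (Fin p) ℝ) :
    quad S V W = ∑ j, ∑ i, V i j * (S * W) i j := by
  simp only [quad, Matrix.trace, Matrix.diag_apply, Matrix.mul_apply (M := Vᵀ),
    Matrix.transpose_apply]

lemma quad_eq_sum₃ (S V W : Matrix (Fin p) (Fin p) ℝ) :
    quad S V W = ∑ j, ∑ i, ∑ l, V i j * (S i l * W l j) := by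
  rw [quad_eq_sum]
  refine Finset.sum_congr rfl fun j _ => Finset.sum_congr rfl fun i _ => ?_
  rw [Matrix.mul_apply, Finset.mul_sum]

lemma quad_comm {S : Matrix (Fin p) (Fin p) ℝ} (hS : Sᵀ = S) (V W : Matrix (Fin p) (Fin p) ℝ) :
    quad S V W = quad S W V := by
  rw [quad, ← Matrix.trace_transpose]
  simp only [Matrix.transpose_mul, Matrix.transpose_transpose, hS, Matrix.mul_assoc, quad]

lemma quad_add_self {S : Matrix (Fin p) (Fin p) ℝ} (hS : Sᵀ = S)
    (V W : Matrix (Fin p) (Fin p) ℝ) :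
    quad S (V + W) (V + W) = quad S V V + 2 * quad S W V + quad S W W := by
  have : quad S (V + W) (V + W) = quad S V V + quad S V W + (quad S W V + quad S W W) := by
    simp only [quad, Matrix.transpose_add, Matrix.mul_add, Matrix.add_mul, Matrix.trace_add]
    ring
  rw [this, quad_comm hS V W]; ring

lemma quad_sub_left (S T V W : Matrix (Fin p) (Fin p) ℝ) :
    quad (S - T) V W = quad S V W - quad T V W := by
  simp only [quad, Matrix.sub_mul, Matrix.mul_sub, Matrix.trace_sub]

/-- The log-likelihood per observation, as a function of the sample covariance matrix `S`. -/
noncomputable def avgLogLik (S U : Matrix (Fin p) (Fin p) ℝ) : ℝ :=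
  ∑ j, Real.log (U j j) - (1 / 2) * quad S (resid U) (resid U)

/-- The penalized log-likelihood per observation. -/
noncomputable def avgObj (q : ℝ → ℝ) (S U : Matrix (Fin p) (Fin p) ℝ) : ℝ :=
  avgLogLik S U - ∑ i, ∑ j, if i = j then 0 else q |U i j|

lemma penLogLik_eq {n : ℕ} (hn : 0 < n) (q : ℝ → ℝ) (X : Matrix (Fin n) (Fin p) ℝ)
    (U : Matrix (Fin p) (Fin p) ℝ) :
    penLogLik q X U = n * avgObj q (sampleCov X) U := by
  have hn' : (n : ℝ) ≠ 0 := by exact_mod_cast hn.ne'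
  have h1 : ∀ k j, U j j * X k j - (X * phiOf U) k j = (X * resid U) k j := by
    intro k j
    rw [Matrix.mul_apply, Matrix.mul_apply, sub_eq_iff_eq_add, ← Finset.sum_add_distrib,
      Finset.sum_eq_single j]
    · simp [resid, phiOf, mul_comm]
    · intro i _ hij
      simp [resid, phiOf, hij]
    · simp
  have h2 : ∑ j, ∑ k, (X * resid U) k j ^ 2 = n * quad (sampleCov X) (resid U) (resid U) := by
    rw [quad, sampleCov, Matrix.smul_mul, Matrix.mul_smul, Matrix.trace_smul, smul_eq_mul,
      mul_inv_cancel_left₀ hn', Matrix.mul_assoc, ← Matrix.mul_assoc, ← Matrix.transpose_mul]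
    simp only [Matrix.trace, Matrix.diag_apply, Matrix.mul_apply (M := (X * resid U)ᵀ),
      Matrix.transpose_apply, sq]
  rw [penLogLik, logLik, avgObj, avgLogLik, Finset.sum_sub_distrib, ← Finset.mul_sum,
    ← Finset.mul_sum]
  simp only [h1, h2]
  ring

lemma continuous_resid : Continuous (resid : Matrix (Fin p) (Fin p) ℝ → _) := by
  refine continuous_matrix fun i j => ?_
  unfold resid
  split_ifs
  · exact continuous_id.matrix_elem i j
  · exact (continuous_id.matrix_elem i j).neg

lemma continuous_quad_resid (S : Matrix (Fin p) (Fin p) ℝ) :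
    Continuous fun U => quad S (resid U) (resid U) :=
  (continuous_resid.matrix_transpose.matrix_mul
    (continuous_const.matrix_mul continuous_resid)).matrix_trace

/-- The change of the log-likelihood, with the logarithm bounded by its tangent line. -/
lemma avgLogLik_add_le {S : Matrix (Fin p) (Fin p) ℝ} (hS : Sᵀ = S)
    {U D : Matrix (Fin p) (Fin p) ℝ} (hU : ∀ j, 0 < U j j) (hUD : ∀ j, 0 < (U + D) j j) :
    avgLogLik S (U + D) ≤ avgLogLik S U + ∑ j, D j j / U j j - quad S (resid D) (resid U)
      - (1 / 2) * quad S (resid D) (resid D) := by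
  have hlog : ∑ j, Real.log ((U + D) j j) ≤ ∑ j, Real.log (U j j) + ∑ j, D j j / U j j := by
    rw [← Finset.sum_add_distrib]
    refine Finset.sum_le_sum fun j _ => ?_
    have h := Real.log_le_sub_one_of_pos (div_pos (hUD j) (hU j))
    rw [Real.log_div (hUD j).ne' (hU j).ne', Matrix.add_apply, add_div, div_self (hU j).ne'] at h
    rw [Matrix.add_apply]
    linarith
  rw [avgLogLik, avgLogLik, resid_add, quad_add_self hS]
  linarith

lemma abs_mul_apply_le {A B : Matrix (Fin p) (Fin p) ℝ} {a : ℝ} (hA : ∀ i j, |A i j| ≤ a)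
    (i j : Fin p) : |(A * B) i j| ≤ a * ∑ l, |B l j| := by
  rw [Matrix.mul_apply, Finset.mul_sum]
  refine (Finset.abs_sum_le_sum_abs _ _).trans (Finset.sum_le_sum fun l _ => ?_)
  rw [abs_mul]
  exact mul_le_mul_of_nonneg_right (hA i l) (abs_nonneg _)

/-- The entrywise `ℓ¹` norm. -/
def sumAbs (A : Matrix (Fin p) (Fin p) ℝ) : ℝ := ∑ i, ∑ j, |A i j|

lemma sumAbs_nonneg (A : Matrix (Fin p) (Fin p) ℝ) : 0 ≤ sumAbs A :=
  Finset.sum_nonneg fun _ _ => Finset.sum_nonneg fun _ _ => abs_nonneg _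

lemma sum_col_le_sumAbs (A : Matrix (Fin p) (Fin p) ℝ) (j : Fin p) :
    ∑ l, |A l j| ≤ sumAbs A :=
  Finset.sum_le_sum fun l _ =>
    Finset.single_le_sum (f := fun j => |A l j|) (fun _ _ => abs_nonneg _) (Finset.mem_univ j)

lemma sum_row_le_sumAbs (A : Matrix (Fin p) (Fin p) ℝ) (i : Fin p) :
    ∑ l, |A i l| ≤ sumAbs A :=
  Finset.single_le_sum (f := fun i => ∑ l, |A i l|)
    (fun _ _ => Finset.sum_nonneg fun _ _ => abs_nonneg _) (Finset.mem_univ i)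

/-- The sum of the squared entries, that is, the squared Frobenius norm. -/
def sumSq (A : Matrix (Fin p) (Fin p) ℝ) : ℝ := ∑ i, ∑ j, A i j ^ 2

lemma sumSq_resid (A : Matrix (Fin p) (Fin p) ℝ) : sumSq (resid A) = sumSq A := by
  simp only [sumSq, resid_sq]

lemma sq_le_sumSq (A : Matrix (Fin p) (Fin p) ℝ) (i j : Fin p) : A i j ^ 2 ≤ sumSq A :=
  (Finset.single_le_sum (f := fun j => A i j ^ 2) (fun _ _ => sq_nonneg _)
    (Finset.mem_univ j)).trans (Finset.single_le_sum (f := fun i => ∑ j, A i j ^ 2)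
      (fun _ _ => Finset.sum_nonneg fun _ _ => sq_nonneg _) (Finset.mem_univ i))

lemma abs_le_of_sumSq_le {A : Matrix (Fin p) (Fin p) ℝ} {r : ℝ} (hr : 0 ≤ r)
    (h : sumSq A ≤ r ^ 2) (i j : Fin p) : |A i j| ≤ r :=
  abs_le_of_sq_le_sq ((sq_le_sumSq A i j).trans h) hr

lemma abs_quad_self_le {E : Matrix (Fin p) (Fin p) ℝ} {k : ℝ} (hE : ∀ i j, |E i j| ≤ k)
    (hk : 0 ≤ k) (V : Matrix (Fin p) (Fin p) ℝ) : |quad E V V| ≤ k * p * sumSq V := by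
  have hsum : ∑ j, ∑ i, ∑ l, k * ((V i j ^ 2 + V l j ^ 2) / 2) = k * p * sumSq V := by
    have : ∀ j, ∑ i, ∑ l, k * ((V i j ^ 2 + V l j ^ 2) / 2) = k * p * ∑ i, V i j ^ 2 := by
      intro j
      simp only [← Finset.mul_sum, ← Finset.sum_div, Finset.sum_add_distrib, Finset.sum_const,
        Finset.card_univ, Fintype.card_fin, nsmul_eq_mul]
      ring
    rw [Finset.sum_congr rfl fun j _ => this j, ← Finset.mul_sum, sumSq, Finset.sum_comm]
  rw [quad_eq_sum₃, ← hsum]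
  refine (Finset.abs_sum_le_sum_abs _ _).trans (Finset.sum_le_sum fun j _ => ?_)
  refine (Finset.abs_sum_le_sum_abs _ _).trans (Finset.sum_le_sum fun i _ => ?_)
  refine (Finset.abs_sum_le_sum_abs _ _).trans (Finset.sum_le_sum fun l _ => ?_)
  rw [abs_mul, abs_mul]
  have h1 : |V i j| * |V l j| ≤ (V i j ^ 2 + V l j ^ 2) / 2 := by
    nlinarith [sq_nonneg (|V i j| - |V l j|), sq_abs (V i j), sq_abs (V l j)]
  calc |V i j| * (|E i l| * |V l j|) = |E i l| * (|V i j| * |V l j|) := by ring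
    _ ≤ k * ((V i j ^ 2 + V l j ^ 2) / 2) := mul_le_mul (hE i l) h1 (by positivity) hk

lemma abs_quad_le {E V W : Matrix (Fin p) (Fin p) ℝ} {k r : ℝ} (hE : ∀ i j, |E i j| ≤ k)
    (hk : 0 ≤ k) (hV : ∀ i j, |V i j| ≤ r) (hr : 0 ≤ r) :
    |quad E V W| ≤ p ^ 2 * (r * (k * sumAbs W)) := by
  have hsum : ∑ _j : Fin p, ∑ _i : Fin p, r * (k * sumAbs W) = p ^ 2 * (r * (k * sumAbs W)) := by
    simp; ring
  rw [quad_eq_sum, ← hsum]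
  refine (Finset.abs_sum_le_sum_abs _ _).trans (Finset.sum_le_sum fun j _ => ?_)
  refine (Finset.abs_sum_le_sum_abs _ _).trans (Finset.sum_le_sum fun i _ => ?_)
  rw [abs_mul]
  exact mul_le_mul (hV i j) ((abs_mul_apply_le hE i j).trans
    (mul_le_mul_of_nonneg_left (sum_col_le_sumAbs W j) hk)) (abs_nonneg _) hr

section Population

variable {Sigma0 : Matrix (Fin p) (Fin p) ℝ}
  {e : Matrix (Fin p) (Fin p) ℝ × Matrix (Fin p) (Fin p) ℝ}

/-- The population quadratic form is coercive; the constant comes from the factorization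
`Σ₀ = Z Zᵀ` with `Z = (R - Φ)⁻ᵀ`. -/
lemma exists_coercive (hS : IsUnit Sigma0.det) (he : e ∈ equivClass Sigma0⁻¹) :
    ∃ c : ℝ, 0 < c ∧ ∀ V, c * sumSq V ≤ quad Sigma0 V V := by
  set W := resid (toU e) with hW
  obtain ⟨Z, hZ⟩ : ∃ Z, Z = Sigma0 * W := ⟨_, rfl⟩
  have hWZ : W * Zᵀ = 1 := by rw [hZ]; exact mul_resid_transpose_mul_resid hS he
  have hZZ : Z * Zᵀ = Sigma0 :=
    calc Z * Zᵀ = Sigma0 * (W * Zᵀ) := by rw [← Matrix.mul_assoc, ← hZ]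
      _ = Sigma0 := by rw [hWZ, Matrix.mul_one]
  have hw : 0 ≤ sumSq W :=
    Finset.sum_nonneg fun _ _ => Finset.sum_nonneg fun _ _ => sq_nonneg _
  refine ⟨1 / (1 + sumSq W), by positivity, fun V => ?_⟩
  have hq : quad Sigma0 V V = ∑ j, ∑ k, (Zᵀ * V) k j ^ 2 := by
    have : quad Sigma0 V V = ((Zᵀ * V)ᵀ * (Zᵀ * V)).trace := by
      rw [quad, ← hZZ]
      simp only [Matrix.transpose_mul, Matrix.transpose_transpose, Matrix.mul_assoc]
    rw [this]
    simp only [Matrix.trace, Matrix.diag_apply, Matrix.mul_apply (M := (Zᵀ * V)ᵀ),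
      Matrix.transpose_apply, sq]
  have hV : V = W * (Zᵀ * V) := by rw [← Matrix.mul_assoc, hWZ, Matrix.one_mul]
  have hle : sumSq V ≤ sumSq W * quad Sigma0 V V := by
    rw [hq]
    calc sumSq V = ∑ i, ∑ j, (W * (Zᵀ * V)) i j ^ 2 := by rw [← hV, sumSq]
      _ ≤ ∑ i, ∑ j, (∑ k, W i k ^ 2) * ∑ k, (Zᵀ * V) k j ^ 2 := by
          refine Finset.sum_le_sum fun i _ => Finset.sum_le_sum fun j _ => ?_
          rw [Matrix.mul_apply]
          exact Finset.sum_mul_sq_le_sq_mul_sq _ _ _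
      _ = _ := by
          simp only [← Finset.mul_sum, ← Finset.sum_mul, sumSq]
  have hq0 : 0 ≤ quad Sigma0 V V := by
    rw [hq]; exact Finset.sum_nonneg fun _ _ => Finset.sum_nonneg fun _ _ => sq_nonneg _
  rw [div_mul_eq_mul_div, one_mul, div_le_iff₀ (by positivity)]
  nlinarith

/-- The off-diagonal entries of `U` vanish outside the support of `B`; the matrices `U` with this
property form the coordinate subspace on which the DAG `B` is fitted. -/
def SuppIn (B U : Matrix (Fin p) (Fin p) ℝ) : Prop := ∀ i j, i ≠ j → B i j = 0 → U i j = 0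

lemma suppIn_toU (h : IsVarianceMatrix e.2) : SuppIn e.1 (toU e) := by
  intro i j hij h0
  by_contra hne
  exact (toU_ne_zero_iff h hij).1 hne h0

lemma sum_div_eq_quad (hS : IsUnit Sigma0.det) (he : e ∈ equivClass Sigma0⁻¹)
    {D : Matrix (Fin p) (Fin p) ℝ} (hD : SuppIn e.1 D) :
    ∑ j, D j j / toU e j j = quad Sigma0 (resid D) (resid (toU e)) := by
  rw [quad_eq_sum]
  refine Finset.sum_congr rfl fun j _ => ?_
  rw [Finset.sum_eq_single j, resid_self, score_diag hS he]
  · ring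
  · intro i _ hij
    by_cases h0 : e.1 i j = 0
    · rw [resid_of_ne _ hij, hD i j hij h0, neg_zero, zero_mul]
    · rw [score_eq_zero hS he hij, mul_zero]
      exact fun hp => he.1 i (.head h0 hp)
  · simp

/-- Quadratic upper bound for the log-likelihood on the coordinate subspace of the DAG `e`. -/
lemma avgLogLik_le_of_suppIn (hS : IsUnit Sigma0.det) (he : e ∈ equivClass Sigma0⁻¹) {c : ℝ}
    (hc : ∀ V, c * sumSq V ≤ quad Sigma0 V V) {S D : Matrix (Fin p) (Fin p) ℝ} (hsymm : Sᵀ = S)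
    {k r : ℝ} (hk : 0 ≤ k) (hr : 0 ≤ r) (hSk : ∀ i j, |S i j - Sigma0 i j| ≤ k)
    (hD : SuppIn e.1 D) (hDr : ∀ i j, |D i j| ≤ r) (hpos : ∀ j, 0 < (toU e + D) j j) :
    avgLogLik S (toU e + D) ≤ avgLogLik S (toU e) + p ^ 2 * (r * (k * sumAbs (toU e)))
      - (1 / 2) * (c - k * p) * sumSq D := by
  have h1 := avgLogLik_add_le hsymm (toU_diag_pos he.2.1) hpos
  rw [sum_div_eq_quad hS he hD] at h1
  have h2 := abs_quad_le (E := S - Sigma0) (V := resid D) (W := resid (toU e)) hSk hk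
    (fun i j => (abs_resid D i j).trans_le (hDr i j)) hr
  rw [quad_sub_left] at h2
  have h3 := abs_quad_self_le (E := S - Sigma0) hSk hk (resid D)
  rw [quad_sub_left, sumSq_resid] at h3
  have h4 := hc (resid D)
  rw [sumSq_resid] at h4
  have h5 : sumAbs (resid (toU e)) = sumAbs (toU e) := by simp only [sumAbs, abs_resid]
  rw [h5] at h2
  have := neg_abs_le (quad S (resid D) (resid (toU e)) - quad Sigma0 (resid D) (resid (toU e)))
  have := neg_abs_le (quad S (resid D) (resid D) - quad Sigma0 (resid D) (resid D))
  linarith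

lemma quad_nonneg_of_close {c : ℝ} (hc : ∀ V, c * sumSq V ≤ quad Sigma0 V V)
    {S : Matrix (Fin p) (Fin p) ℝ} {k : ℝ} (hk : 0 ≤ k) (hkc : k * p ≤ c)
    (hSk : ∀ i j, |S i j - Sigma0 i j| ≤ k) (V : Matrix (Fin p) (Fin p) ℝ) : 0 ≤ quad S V V := by
  have h3 := abs_quad_self_le (E := S - Sigma0) hSk hk V
  rw [quad_sub_left] at h3
  have := neg_abs_le (quad S V V - quad Sigma0 V V)
  have hs : 0 ≤ sumSq V :=
    Finset.sum_nonneg fun _ _ => Finset.sum_nonneg fun _ _ => sq_nonneg _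
  nlinarith [hc V]

end Population

end Objective

/-! ### Local maximizers over the DAG space -/

section LocalMax

variable {p : ℕ} {Sigma0 : Matrix (Fin p) (Fin p) ℝ}
  {e : Matrix (Fin p) (Fin p) ℝ × Matrix (Fin p) (Fin p) ℝ}

lemma continuous_sumSq : Continuous (sumSq : Matrix (Fin p) (Fin p) ℝ → ℝ) :=
  continuous_finsetSum _ fun i _ => continuous_finsetSum _ fun j _ =>
    (continuous_id.matrix_elem i j).pow 2

/-- If the objective is smaller on a sphere around `U₀` in the coordinate subspace of the support of
`B` than at `U₀`, then it has a maximizer over the ball that lies in the open ball. -/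
lemma exists_max_of_sphere {B U₀ S : Matrix (Fin p) (Fin p) ℝ} {q : ℝ → ℝ} {r : ℝ}
    (hq : ContinuousOn q (Set.Ioi 0)) (hr : 0 < r) (hB : SuppIn B U₀)
    (hpos : ∀ j, r < U₀ j j) (hne : ∀ i j, i ≠ j → B i j ≠ 0 → r < |U₀ i j|)
    (hsphere : ∀ D, SuppIn B D → sumSq D = r ^ 2 → avgObj q S (U₀ + D) < avgObj q S U₀) :
    ∃ U, SuppIn B U ∧ sumSq (U - U₀) < r ^ 2 ∧
      ∀ U', SuppIn B U' → sumSq (U' - U₀) ≤ r ^ 2 → avgObj q S U' ≤ avgObj q S U := by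
  set C : Set (Matrix (Fin p) (Fin p) ℝ) := {U | SuppIn B U ∧ sumSq (U - U₀) ≤ r ^ 2} with hC
  have hclose : ∀ U ∈ C, ∀ i j, |U i j - U₀ i j| ≤ r := fun U hU i j =>
    abs_le_of_sumSq_le hr.le hU.2 i j
  have hclosed : IsClosed C := by
    refine IsClosed.inter ?_ (isClosed_le (continuous_sumSq.comp (continuous_id.sub
      continuous_const)) continuous_const)
    have : {U : Matrix (Fin p) (Fin p) ℝ | SuppIn B U}
        = ⋂ i, ⋂ j, ⋂ (_ : i ≠ j), ⋂ (_ : B i j = 0), {U | U i j = 0} := by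
      ext U; simp [SuppIn]
    change IsClosed {U : Matrix (Fin p) (Fin p) ℝ | SuppIn B U}
    rw [this]
    exact isClosed_iInter fun i => isClosed_iInter fun j => isClosed_iInter fun _ =>
      isClosed_iInter fun _ => isClosed_eq (continuous_id.matrix_elem i j) continuous_const
  have hcomp : IsCompact C := by
    have hK : IsCompact (Set.pi Set.univ fun i : Fin p => Set.pi Set.univ fun j : Fin p =>
        Set.Icc (U₀ i j - r) (U₀ i j + r)) :=
      isCompact_univ_pi fun i => isCompact_univ_pi fun j => isCompact_Icc
    refine IsCompact.of_isClosed_subset hK hclosed fun U hU i _ j _ => ?_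
    have := abs_le.1 (hclose U hU i j)
    exact ⟨by linarith [this.1], by linarith [this.2]⟩
  have hcont : ContinuousOn (avgObj q S) C := by
    have hlog : ContinuousOn (fun U : Matrix (Fin p) (Fin p) ℝ => ∑ j, Real.log (U j j)) C := by
      refine continuousOn_finsetSum _ fun j _ => ContinuousOn.log
        (continuous_id.matrix_elem j j).continuousOn fun U hU => ne_of_gt ?_
      have := abs_le.1 (hclose U hU j j)
      have := hpos j
      change 0 < U j j
      linarith
    have hquad : ContinuousOn (fun U : Matrix (Fin p) (Fin p) ℝ =>
        (1 / 2) * quad S (resid U) (resid U)) C :=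
      (continuous_const.mul (continuous_quad_resid S)).continuousOn
    refine (hlog.sub hquad).sub (continuousOn_finsetSum _ fun i _ =>
      continuousOn_finsetSum _ fun j _ => ?_)
    by_cases hij : i = j
    · simp only [hij, if_true]; exact continuousOn_const
    simp only [hij, if_false]
    by_cases h0 : B i j = 0
    · exact (continuousOn_const (c := q 0)).congr fun U hU => by
        change q |U i j| = q 0
        rw [hU.1 i j hij h0, abs_zero]
    · refine hq.comp (continuous_id.matrix_elem i j).abs.continuousOn fun U hU => ?_
      have h1 := hclose U hU i j
      have h2 := hne i j hij h0
      have h3 := abs_sub_abs_le_abs_sub (U₀ i j) (U i j)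
      rw [abs_sub_comm] at h3
      change 0 < |U i j|
      linarith
  have h0 : U₀ ∈ C := ⟨hB, by simp [sumSq]; positivity⟩
  obtain ⟨U, hU, hmax⟩ := hcomp.exists_isMaxOn ⟨U₀, h0⟩ hcont
  refine ⟨U, hU.1, lt_of_le_of_ne hU.2 fun heq => ?_, fun U' h1 h2 => hmax ⟨h1, h2⟩⟩
  have hD : SuppIn B (U - U₀) := fun i j hij hz => by
    rw [Matrix.sub_apply, hU.1 i j hij hz, hB i j hij hz, sub_zero]
  have h1 := hsphere _ hD heq
  rw [add_sub_cancel] at h1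
  exact (hmax h0).not_gt h1

/-- Adding edges does not help: near a point of the coordinate subspace of `e`, the off-support
entries of a DAG change the log-likelihood at a rate at most `κ`, because its topological orders
are topological orders of `e`, while the penalty costs at least `κ` per unit. -/
lemma isLocalMaxOn_of_subspace (hS : IsUnit Sigma0.det) (he : e ∈ equivClass Sigma0⁻¹)
    {q : ℝ → ℝ} {S U : Matrix (Fin p) (Fin p) ℝ} {k r κ : ℝ} (hsymm : Sᵀ = S) (hk : 0 ≤ k)
    (hSk : ∀ i j, |S i j - Sigma0 i j| ≤ k) (hSpos : ∀ V, 0 ≤ quad S V V) (hr : 0 < r)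
    (hpos : ∀ j, r < toU e j j) (hne : ∀ i j, i ≠ j → e.1 i j ≠ 0 → r < |toU e i j|)
    (hq0 : q 0 = 0) (hq : ∃ δ : ℝ, 0 < δ ∧ ∀ t, 0 < t → t < δ → κ * t ≤ q t)
    (hκ : k * (sumAbs (toU e) + p * r) + sumAbs Sigma0 * r ≤ κ)
    (hU : SuppIn e.1 U) (hUr : sumSq (U - toU e) < r ^ 2)
    (hmax : ∀ U', SuppIn e.1 U' → sumSq (U' - toU e) ≤ r ^ 2 → avgObj q S U' ≤ avgObj q S U) :
    U ∈ dagSpace p ∧ IsLocalMaxOn (avgObj q S) (dagSpace p) U ∧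
      (∀ i j, i ≠ j → (U i j ≠ 0 ↔ e.1 i j ≠ 0)) ∧ ∀ i j, |U i j - toU e i j| ≤ r := by
  have hclose : ∀ i j, |U i j - toU e i j| ≤ r := fun i j =>
    abs_le_of_sumSq_le hr.le hUr.le i j
  have hUpos : ∀ j, 0 < U j j := fun j => by
    have := abs_le.1 (hclose j j)
    linarith [hpos j]
  have hsupp : ∀ i j, i ≠ j → (U i j ≠ 0 ↔ e.1 i j ≠ 0) := by
    refine fun i j hij => ⟨fun h h0 => h (hU i j hij h0), fun h h0 => ?_⟩
    have h1 := hclose i j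
    rw [h0, zero_sub, abs_neg] at h1
    exact (hne i j hij h).not_ge h1
  have hdag : U ∈ dagSpace p := by
    refine ⟨he.1.mono fun i j h => ?_, hUpos⟩
    by_cases hij : i = j
    · simp [phiOf, hij] at h
    · simp only [phiOf, hij, if_false] at h
      exact (hsupp i j hij).1 h
  refine ⟨hdag, ?_, hsupp, hclose⟩
  obtain ⟨δ, hδ, hqδ⟩ := hq
  have hκ0 : 0 ≤ κ := by
    refine le_trans ?_ hκ
    have := sumAbs_nonneg (toU e); have := sumAbs_nonneg Sigma0
    positivity
  have hq' : ∀ t, 0 ≤ t → t < δ → κ * t ≤ q t := fun t ht htδ => by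
    rcases ht.eq_or_lt with rfl | h
    · simp [hq0]
    · exact hqδ t h htδ
  have ev1 : ∀ᶠ U' in 𝓝 U, sumSq (U' - toU e) < r ^ 2 :=
    (continuous_sumSq.comp (continuous_id.sub continuous_const)).continuousAt.eventually_lt_const
      hUr
  have ev2 : ∀ᶠ U' in 𝓝 U, ∀ i j, |U' i j - U i j| < δ := by
    refine eventually_all.2 fun i => eventually_all.2 fun j => ?_
    have : Continuous fun U' : Matrix (Fin p) (Fin p) ℝ => |U' i j - U i j| :=
      ((continuous_id.matrix_elem i j).sub continuous_const).abs
    exact this.continuousAt.eventually_lt_const (by simpa using hδ)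
  have ev3 : ∀ᶠ U' in 𝓝 U, ∀ i j, U i j ≠ 0 → U' i j ≠ 0 := by
    refine eventually_all.2 fun i => eventually_all.2 fun j => ?_
    by_cases h : U i j = 0
    · simp [h]
    · simp only [ne_eq, h, not_false_eq_true, forall_const]
      exact (continuous_id.matrix_elem i j).continuousAt.eventually_ne h
  change ∀ᶠ U' in 𝓝[dagSpace p] U, avgObj q S U' ≤ avgObj q S U
  filter_upwards [ev1.filter_mono nhdsWithin_le_nhds, ev2.filter_mono nhdsWithin_le_nhds,
    ev3.filter_mono nhdsWithin_le_nhds, self_mem_nhdsWithin] with U' h1 h2 h3 hU'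
  -- Split `U' = V + D` into its part on the support of `e` and the remaining entries.
  obtain ⟨V, hV⟩ : ∃ V : Matrix (Fin p) (Fin p) ℝ,
    ∀ i j, V i j = if i = j ∨ e.1 i j ≠ 0 then U' i j else 0 := ⟨_, fun _ _ => rfl⟩
  obtain ⟨D, hD⟩ : ∃ D : Matrix (Fin p) (Fin p) ℝ,
    ∀ i j, D i j = if i = j ∨ e.1 i j ≠ 0 then 0 else U' i j := ⟨_, fun _ _ => rfl⟩
  have hVD : V + D = U' := by
    ext i j
    rw [Matrix.add_apply, hV, hD]
    split_ifs <;> simp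
  have hVsupp : SuppIn e.1 V := fun i j hij h0 => by simp [hV, hij, h0]
  have hU0 := suppIn_toU (e := e) he.2.1
  have hVr : sumSq (V - toU e) ≤ r ^ 2 := by
    refine le_trans (Finset.sum_le_sum fun i _ => Finset.sum_le_sum fun j _ => ?_) h1.le
    simp only [Matrix.sub_apply, hV]
    split_ifs with h
    · exact le_rfl
    · push Not at h
      rw [hU0 i j h.1 h.2]; simp; positivity
  have hVclose : ∀ i j, |V i j - toU e i j| ≤ r := fun i j =>
    abs_le_of_sumSq_le hr.le hVr i j
  have hVpos : ∀ j, 0 < V j j := fun j => by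
    have := abs_le.1 (hVclose j j)
    linarith [hpos j]
  have hDdiag : ∀ j, D j j = 0 := fun j => by simp [hD]
  refine le_trans ?_ (hmax V hVsupp hVr)
  have hlik := avgLogLik_add_le hsymm hVpos (D := D) (by rw [hVD]; exact hU'.2)
  simp only [hDdiag, zero_div, Finset.sum_const_zero, add_zero] at hlik
  rw [hVD] at hlik
  have hpen : (∑ i, ∑ j, if i = j then 0 else q |U' i j|)
      = (∑ i, ∑ j, if i = j then 0 else q |V i j|) + ∑ i, ∑ j, q |D i j| := by
    rw [← Finset.sum_add_distrib]
    refine Finset.sum_congr rfl fun i _ => ?_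
    rw [← Finset.sum_add_distrib]
    refine Finset.sum_congr rfl fun j _ => ?_
    by_cases hij : i = j
    · simp [hij, hD, hq0]
    · by_cases h0 : e.1 i j = 0 <;> simp [hij, hV, hD, h0, hq0]
  have hpenD : ∑ i, ∑ j, κ * |D i j| ≤ ∑ i, ∑ j, q |D i j| := by
    refine Finset.sum_le_sum fun i _ => Finset.sum_le_sum fun j _ => hq' _ (abs_nonneg _) ?_
    simp only [hD]
    split_ifs with h
    · simpa using hδ
    · push Not at h
      have := h2 i j
      rwa [hU i j h.1 h.2, sub_zero] at this
  have hscore : -quad S (resid D) (resid V) ≤ ∑ i, ∑ j, κ * |D i j| := by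
    rw [quad_eq_sum, Finset.sum_comm, ← Finset.sum_neg_distrib]
    refine Finset.sum_le_sum fun i _ => ?_
    rw [← Finset.sum_neg_distrib]
    refine Finset.sum_le_sum fun j _ => (neg_le_abs _).trans ?_
    rw [abs_mul, abs_resid, mul_comm]
    by_cases hDij : D i j = 0
    · simp [hDij]
    refine mul_le_mul_of_nonneg_right ?_ (abs_nonneg _)
    have hij : i ≠ j := fun h => hDij (by simp [hD, h])
    have hU'ij : U' i j ≠ 0 := fun h => hDij (by simp [hD, h])
    have hpath : ¬ Relation.TransGen (fun a b => e.1 a b ≠ 0) j i := by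
      intro hp
      have hp' : Relation.TransGen (fun a b => phiOf U' a b ≠ 0) j i := by
        refine Relation.TransGen.mono (fun a b hab => ?_) _ _ hp
        have hne : a ≠ b := fun h => hab (by rw [h]; exact he.1.apply_self b)
        simp only [phiOf, hne, if_false]
        exact h3 a b ((hsupp a b hne).2 hab)
      exact hU'.1 j (hp'.tail (by simpa [phiOf, hij] using hU'ij))
    have hzero := score_eq_zero hS he hij hpath
    have hsplit : (S * resid V) i j
        = ((S - Sigma0) * resid V) i j + (Sigma0 * resid (V - toU e)) i j := by
      have hres : resid V = resid (V - toU e) + resid (toU e) := by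
        rw [← resid_add, sub_add_cancel]
      have hz : (Sigma0 * resid V) i j = (Sigma0 * resid (V - toU e)) i j := by
        rw [hres, Matrix.mul_add, Matrix.add_apply, hzero, add_zero]
      rw [Matrix.sub_mul, Matrix.sub_apply, hz]; ring
    have hcol : ∑ l, |resid V l j| ≤ sumAbs (toU e) + p * r := by
      calc ∑ l, |resid V l j| ≤ ∑ l, (|toU e l j| + r) := by
            refine Finset.sum_le_sum fun l _ => ?_
            rw [abs_resid]
            have := abs_sub_abs_le_abs_sub (V l j) (toU e l j)
            linarith [hVclose l j]
        _ = ∑ l, |toU e l j| + p * r := by simp [Finset.sum_add_distrib]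
        _ ≤ _ := by linarith [sum_col_le_sumAbs (toU e) j]
    have hb1 : |((S - Sigma0) * resid V) i j| ≤ k * (sumAbs (toU e) + p * r) :=
      (abs_mul_apply_le (A := S - Sigma0) hSk i j).trans (mul_le_mul_of_nonneg_left hcol hk)
    have hb2 : |(Sigma0 * resid (V - toU e)) i j| ≤ sumAbs Sigma0 * r := by
      rw [Matrix.mul_apply]
      calc |∑ l, Sigma0 i l * resid (V - toU e) l j|
          ≤ ∑ l, |Sigma0 i l| * r := by
            refine (Finset.abs_sum_le_sum_abs _ _).trans (Finset.sum_le_sum fun l _ => ?_)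
            rw [abs_mul, abs_resid]
            exact mul_le_mul_of_nonneg_left (hVclose l j) (abs_nonneg _)
        _ = (∑ l, |Sigma0 i l|) * r := by rw [Finset.sum_mul]
        _ ≤ _ := mul_le_mul_of_nonneg_right (sum_row_le_sumAbs Sigma0 i) hr.le
    rw [hsplit]
    exact (abs_add_le _ _).trans ((add_le_add hb1 hb2).trans hκ)
  rw [avgObj, avgObj, hpen]
  linarith [hSpos (resid D)]

end LocalMax

/-! ### Existence of consistent local maximizers -/

section Existence

variable {p : ℕ} {Sigma0 : Matrix (Fin p) (Fin p) ℝ}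
  {e : Matrix (Fin p) (Fin p) ℝ × Matrix (Fin p) (Fin p) ℝ} {pen : ℕ → ℝ → ℝ} {lam : ℕ → ℝ}

/-- By concavity, the lower bound on the derivatives near zero gives a linear lower bound on the
penalty itself. -/
lemma exists_pen_linear_lower (hconc : ∀ n, ConcaveOn ℝ (Set.Ici 0) (pen n))
    (hzero : ∀ n, pen n 0 = 0)
    (hliminf : 0 < liminf (fun n =>
      liminf (fun t : ℝ => ((deriv (pen n) t / lam n : ℝ) : EReal)) (𝓝[>] 0)) atTop)
    (hlam : Tendsto (fun n : ℕ => lam n * √(n : ℝ)) atTop atTop) :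
    ∃ c : ℝ, 0 < c ∧ ∀ᶠ n in atTop, ∃ δ : ℝ, 0 < δ ∧
      ∀ t, 0 < t → t < δ → c * lam n * t ≤ pen n t := by
  obtain ⟨c, hc0, hc⟩ := EReal.lt_iff_exists_real_btwn.1 hliminf
  have hc0' : 0 < c := by exact_mod_cast hc0
  refine ⟨c, hc0', ?_⟩
  filter_upwards [eventually_lt_of_lt_liminf hc, hlam.eventually_gt_atTop 0] with n hn hl
  have hlam0 : 0 < lam n := pos_of_mul_pos_left hl (Real.sqrt_nonneg _)
  have h := eventually_lt_of_lt_liminf hn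
  obtain ⟨δ, hδ, hsub⟩ := mem_nhdsGT_iff_exists_Ioo_subset.1 h
  refine ⟨δ, hδ, fun t ht htδ => ?_⟩
  have hd : (c : EReal) < ((deriv (pen n) t / lam n : ℝ) : EReal) := hsub ⟨ht, htδ⟩
  have hd' : c * lam n < deriv (pen n) t := by
    rw [← lt_div_iff₀ hlam0]; exact_mod_cast hd
  have hdiff : DifferentiableAt ℝ (pen n) t :=
    differentiableAt_of_deriv_ne_zero ((mul_pos hc0' hlam0).trans hd').ne'
  have hs := (hconc n).le_slope_of_hasDerivAt (x := 0) (y := t) (by simp) ht.le ht hdiff.hasDerivAt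
  rw [slope_def_field, hzero, sub_zero, sub_zero, le_div_iff₀ ht] at hs
  exact (mul_le_mul_of_nonneg_right hd'.le ht.le).trans hs

lemma mem_matSupp_phiOf {U : Matrix (Fin p) (Fin p) ℝ} {i j : Fin p} (hij : i ≠ j)
    (h : U i j ≠ 0) : (i, j) ∈ matSupp (phiOf U) := by
  simpa [matSupp, phiOf, hij] using h

lemma abs_deriv_le_aSeq (pen : ℕ → ℝ → ℝ) {U : Matrix (Fin p) (Fin p) ℝ} {i j : Fin p}
    (hij : i ≠ j) (h : U i j ≠ 0) (n : ℕ) : |deriv (pen n) (abs (U i j))| ≤ aSeq pen U n :=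
  le_csSup (Set.toFinite _).bddAbove ⟨(i, j), mem_matSupp_phiOf hij h, rfl⟩

lemma abs_deriv_deriv_le_bSeq (pen : ℕ → ℝ → ℝ) {U : Matrix (Fin p) (Fin p) ℝ} {i j : Fin p}
    (hij : i ≠ j) (h : U i j ≠ 0) (n : ℕ) :
    |deriv (deriv (pen n)) (abs (U i j))| ≤ bSeq pen U n :=
  le_csSup (Set.toFinite _).bddAbove ⟨(i, j), mem_matSupp_phiOf hij h, rfl⟩

lemma cSeq_le (pen : ℕ → ℝ → ℝ) {U : Matrix (Fin p) (Fin p) ℝ} {i j : Fin p}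
    (hij : i ≠ j) (h : U i j ≠ 0) (n : ℕ) : cSeq pen U n ≤ pen n (abs (U i j)) :=
  csInf_le (Set.toFinite _).bddBelow ⟨(i, j), mem_matSupp_phiOf hij h, rfl⟩

/-- At scale `n^{-1/2}` the penalty of a nonzero entry changes by `O(n⁻¹)`. -/
lemma pen_sub_le {f : ℝ → ℝ} {x d a b M : ℝ} {n : ℕ} (hn : 0 < n)
    (hexp : ∀ h : ℝ, |h| ≤ M / √(n : ℝ) → (n : ℝ) * |f (|x| + h) - f |x| - deriv f |x| * h
      - deriv (deriv f) |x| / 2 * h ^ 2| ≤ 1)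
    (hd : |d| ≤ M * (1 / √(n : ℝ))) (ha : |deriv f (abs x)| ≤ a * (1 / √(n : ℝ)))
    (hb : |deriv (deriv f) (abs x)| ≤ b) :
    f |x| - f |x + d| ≤ (a * M + b * M ^ 2 / 2 + 1) * (1 / √(n : ℝ)) ^ 2 := by
  have hn' : (0 : ℝ) < n := by exact_mod_cast hn
  set s : ℝ := 1 / √(n : ℝ) with hs
  have hs0 : 0 < s := by positivity
  have hs2 : s ^ 2 = 1 / n := by rw [hs, div_pow, Real.sq_sqrt hn'.le, one_pow]
  set h := |x + d| - |x| with hh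
  have hhd : |h| ≤ M * s := by
    refine le_trans ?_ hd
    have := abs_abs_sub_abs_le_abs_sub (x + d) x
    rwa [add_sub_cancel_left] at this
  have h1 := hexp h (hhd.trans_eq (by rw [hs]; ring))
  rw [hh, add_sub_cancel, ← hh, mul_comm, ← le_div_iff₀ hn', ← hs2] at h1
  have h2 := (abs_le.1 h1).1
  have h3 : |deriv f |x| * h| ≤ a * s * (M * s) := by
    rw [abs_mul]; exact mul_le_mul ha hhd (abs_nonneg _) ((abs_nonneg _).trans ha)
  have h4 : |deriv (deriv f) |x| / 2 * h ^ 2| ≤ b / 2 * (M * s) ^ 2 := by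
    rw [abs_mul, abs_div, abs_two, abs_pow]
    exact mul_le_mul (by linarith) (pow_le_pow_left₀ (abs_nonneg _) hhd 2) (by positivity)
      (by linarith [(abs_nonneg _).trans hb])
  have h3' := (abs_le.1 h3).1
  have h4' := (abs_le.1 h4).1
  nlinarith

/-- The penalized likelihood is smaller on the sphere of radius `M n^{-1/2}` in the coordinate
subspace of `e` than at its centre, as soon as the quadratic form dominates. -/
lemma avgObj_lt_on_sphere (hS : IsUnit Sigma0.det) (he : e ∈ equivClass Sigma0⁻¹)
    {f : ℕ → ℝ → ℝ} {n : ℕ} (hn : 0 < n) {c K M A C0 s : ℝ}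
    (hcoer : ∀ V, c * sumSq V ≤ quad Sigma0 V V) (hK : 0 < K) (hM0 : 0 < M) (hA : 0 < A)
    (hC0 : C0 = sumAbs (toU e)) (hs : s = 1 / √(n : ℝ))
    (hkey : (p : ℝ) ^ 2 * (C0 * K + A) * M + (p : ℝ) ^ 2 < c / 8 * M ^ 2)
    (h1 : ∀ j, M * s < toU e j j)
    (h3 : ∀ i j, i ≠ j → e.1 i j ≠ 0 → ∀ h : ℝ, |h| ≤ M / √(n : ℝ) →
      (n : ℝ) * |f n (|toU e i j| + h) - f n |toU e i j| - deriv (f n) |toU e i j| * h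
      - deriv (deriv (f n)) |toU e i j| / 2 * h ^ 2| ≤ 1)
    (haS : aSeq f (toU e) n ≤ A * s) (h7 : K * s * p ≤ c / 2)
    (h8 : (p : ℝ) ^ 2 * (bSeq f (toU e) n / 2) ≤ c / 8)
    {S : Matrix (Fin p) (Fin p) ℝ} (hsymm : Sᵀ = S)
    (hSk : ∀ i j, |S i j - Sigma0 i j| ≤ K * s) {D : Matrix (Fin p) (Fin p) ℝ}
    (hD : SuppIn e.1 D) (hDr : sumSq D = (M * s) ^ 2) :
    avgObj (f n) S (toU e + D) < avgObj (f n) S (toU e) := by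
  have hn' : (0 : ℝ) < n := by exact_mod_cast hn
  have hs0 : 0 < s := by rw [hs]; positivity
  have hk0 : 0 ≤ K * s := by positivity
  have hr0 : 0 < M * s := by positivity
  have hDle := abs_le_of_sumSq_le hr0.le hDr.le
  have hposD : ∀ j, 0 < (toU e + D) j j := fun j => by
    have := (abs_le.1 (hDle j j)).1
    have := h1 j
    rw [Matrix.add_apply]; linarith
  have hlik := avgLogLik_le_of_suppIn hS he hcoer hsymm hk0 hr0.le hSk hD hDle hposD
  rw [hDr, ← hC0] at hlik
  obtain ⟨β, hβ⟩ : ∃ β, β = (A * M + bSeq f (toU e) n * M ^ 2 / 2 + 1) * s ^ 2 := ⟨_, rfl⟩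
  have hb0 : 0 ≤ bSeq f (toU e) n :=
    Real.sSup_nonneg (by rintro _ ⟨_, _, rfl⟩; exact abs_nonneg _)
  have hβ0 : 0 ≤ β := by rw [hβ]; positivity
  have hpendiff : (∑ i, ∑ j, if i = j then 0 else f n |toU e i j|)
      - (∑ i, ∑ j, if i = j then 0 else f n |(toU e + D) i j|) ≤ p ^ 2 * β := by
    have hsum : ∑ _i : Fin p, ∑ _j : Fin p, β = p ^ 2 * β := by simp; ring
    rw [← Finset.sum_sub_distrib, ← hsum]
    refine Finset.sum_le_sum fun i _ => ?_
    rw [← Finset.sum_sub_distrib]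
    refine Finset.sum_le_sum fun j _ => ?_
    by_cases hij : i = j
    · simpa [hij] using hβ0
    simp only [hij, if_false]
    by_cases h0 : e.1 i j = 0
    · rw [Matrix.add_apply, hD i j hij h0, add_zero, sub_self]
      exact hβ0
    have hne := (toU_ne_zero_iff he.2.1 hij).2 h0
    rw [Matrix.add_apply]
    rw [hβ, hs]
    exact pen_sub_le hn (h3 i j hij h0) ((hDle i j).trans_eq (by rw [hs]))
      ((abs_deriv_le_aSeq f hij hne n).trans (haS.trans_eq (by rw [hs])))
      (abs_deriv_deriv_le_bSeq f hij hne n)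
  have hs2 : 0 < s ^ 2 := by positivity
  have hquad : c / 4 * M ^ 2 * s ^ 2 ≤ (1 / 2) * (c - K * s * p) * (M * s) ^ 2 := by
    have : 0 ≤ (c / 2 - K * s * p) * (M * s) ^ 2 := mul_nonneg (by linarith) (by positivity)
    nlinarith
  have hb2 : (p : ℝ) ^ 2 * (bSeq f (toU e) n / 2) * M ^ 2 ≤ c / 8 * M ^ 2 :=
    mul_le_mul_of_nonneg_right h8 (by positivity)
  have hlt : (p : ℝ) ^ 2 * (C0 * K + A) * M + (p : ℝ) ^ 2
      + (p : ℝ) ^ 2 * (bSeq f (toU e) n / 2) * M ^ 2 < c / 4 * M ^ 2 := by linarith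
  have hlt' := mul_lt_mul_of_pos_right hlt hs2
  have heq : (p : ℝ) ^ 2 * (M * s * (K * s * C0)) + p ^ 2 * β
      = ((p : ℝ) ^ 2 * (C0 * K + A) * M + (p : ℝ) ^ 2
        + (p : ℝ) ^ 2 * (bSeq f (toU e) n / 2) * M ^ 2) * s ^ 2 := by rw [hβ]; ring
  rw [avgObj, avgObj]
  linarith

/-- The deterministic core of the existence part: if the sample covariance matrix is within
`K n^{-1/2}` of `Σ₀`, the penalized likelihood has a local maximizer over the DAG space with the
support of `e` within `M n^{-1/2}` of `e`. -/
lemma exists_localMax (hS : IsUnit Sigma0.det) (he : e ∈ equivClass Sigma0⁻¹)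
    (hconc : ∀ n, ConcaveOn ℝ (Set.Ici 0) (pen n)) (hzero : ∀ n, pen n 0 = 0)
    (hliminf : 0 < liminf (fun n =>
      liminf (fun t : ℝ => ((deriv (pen n) t / lam n : ℝ) : EReal)) (𝓝[>] 0)) atTop)
    (ha : aSeq pen (toU e) =O[atTop] fun n : ℕ => 1 / √(n : ℝ))
    (hb : Tendsto (bSeq pen (toU e)) atTop (𝓝 0))
    (hexp : ∀ i j, phiOf (toU e) i j ≠ 0 → SecondOrderExpansion pen |phiOf (toU e) i j|)
    (hlam : Tendsto (fun n : ℕ => lam n * √(n : ℝ)) atTop atTop) {K : ℝ} (hK : 0 < K) :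
    ∃ M : ℝ, ∀ᶠ n : ℕ in atTop, ∀ S : Matrix (Fin p) (Fin p) ℝ, Sᵀ = S →
      (∀ i j, |S i j - Sigma0 i j| ≤ K * (1 / √(n : ℝ))) →
      ∃ U, U ∈ dagSpace p ∧ IsLocalMaxOn (avgObj (pen n) S) (dagSpace p) U ∧
        (∀ i j, i ≠ j → (U i j ≠ 0 ↔ e.1 i j ≠ 0)) ∧
        ∀ i j, |U i j - toU e i j| ≤ M * (1 / √(n : ℝ)) := by
  obtain ⟨c, hc, hcoer⟩ := exists_coercive hS he
  obtain ⟨c', hc', hpen⟩ := exists_pen_linear_lower hconc hzero hliminf hlam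
  obtain ⟨A, hA, haA⟩ := ha.exists_pos
  obtain ⟨C0, hC0⟩ : ∃ C0, C0 = sumAbs (toU e) := ⟨_, rfl⟩
  have hC00 : 0 ≤ C0 := hC0 ▸ sumAbs_nonneg _
  obtain ⟨C1, hC1⟩ : ∃ C1, C1 = sumAbs Sigma0 := ⟨_, rfl⟩
  have hC10 : 0 ≤ C1 := hC1 ▸ sumAbs_nonneg _
  obtain ⟨G, hG⟩ : ∃ G, G = (p : ℝ) ^ 2 * (C0 * K + A + 1) := ⟨_, rfl⟩
  have hG0 : 0 ≤ G := by rw [hG]; positivity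
  -- `M` is chosen so that the quadratic term `c M² / 8` beats the linear term `G M`.
  obtain ⟨M, hM⟩ : ∃ M, M = 1 + 8 * G / c := ⟨_, rfl⟩
  have hM1 : 1 ≤ M := by
    rw [hM]
    have : 0 ≤ 8 * G / c := by positivity
    linarith
  have hMc : c / 8 * M = c / 8 + G := by rw [hM]; field_simp
  have hkey : (p : ℝ) ^ 2 * (C0 * K + A) * M + (p : ℝ) ^ 2 < c / 8 * M ^ 2 := by
    have h1 : c / 8 * M ^ 2 = (c / 8 + G) * M := by rw [← hMc]; ring
    rw [h1, hG]
    have : 0 ≤ (p : ℝ) ^ 2 * (M - 1) := mul_nonneg (by positivity) (by linarith)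
    have : 0 < c / 8 * M := by positivity
    nlinarith
  have hM0 : 0 < M := by linarith
  have tMs : Tendsto (fun n : ℕ => M * (1 / √(n : ℝ))) atTop (𝓝 0) := by
    simpa using tendsto_rate.const_mul M
  have tKs : Tendsto (fun n : ℕ => K * (1 / √(n : ℝ)) * p) atTop (𝓝 0) := by
    simpa using (tendsto_rate.const_mul K).mul_const (p : ℝ)
  have tb : Tendsto (fun n => (p : ℝ) ^ 2 * (bSeq pen (toU e) n / 2)) atTop (𝓝 0) := by
    simpa using (hb.div_const 2).const_mul ((p : ℝ) ^ 2)
  have hpos := toU_diag_pos he.2.1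
  have ev1 : ∀ᶠ n : ℕ in atTop, ∀ j, M * (1 / √(n : ℝ)) < toU e j j :=
    eventually_all.2 fun j => tMs.eventually_lt_const (hpos j)
  have ev2 : ∀ᶠ n : ℕ in atTop, ∀ i j, i ≠ j → e.1 i j ≠ 0 →
      M * (1 / √(n : ℝ)) < |toU e i j| := by
    refine eventually_all.2 fun i => eventually_all.2 fun j => ?_
    by_cases h : i ≠ j ∧ e.1 i j ≠ 0
    · filter_upwards [tMs.eventually_lt_const
        (abs_pos.2 ((toU_ne_zero_iff he.2.1 h.1).2 h.2))] with n hn _ _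
      exact hn
    · exact Eventually.of_forall fun n h1 h2 => absurd ⟨h1, h2⟩ h
  have ev3 : ∀ᶠ n : ℕ in atTop, ∀ i j, i ≠ j → e.1 i j ≠ 0 → ∀ h : ℝ, |h| ≤ M / √(n : ℝ) →
      (n : ℝ) * |pen n (|toU e i j| + h) - pen n |toU e i j| - deriv (pen n) |toU e i j| * h
      - deriv (deriv (pen n)) |toU e i j| / 2 * h ^ 2| ≤ 1 := by
    refine eventually_all.2 fun i => eventually_all.2 fun j => ?_
    by_cases h : i ≠ j ∧ e.1 i j ≠ 0
    · have hphi : phiOf (toU e) i j = toU e i j := by simp [phiOf, h.1]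
      have := hexp i j (by rw [hphi]; exact (toU_ne_zero_iff he.2.1 h.1).2 h.2)
      rw [hphi] at this
      filter_upwards [this.2 M hM0 1 one_pos] with n hn _ _
      exact hn
    · exact Eventually.of_forall fun n h1 h2 => absurd ⟨h1, h2⟩ h
  refine ⟨M, ?_⟩
  filter_upwards [ev1, ev2, ev3, hpen, haA.bound, eventually_gt_atTop 0,
    tMs.eventually_le_const one_pos, tKs.eventually_le_const (half_pos hc),
    tb.eventually_le_const (show 0 < c / 8 by positivity),
    hlam.eventually_ge_atTop ((K * (C0 + p) + C1 * M) / c')]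
    with n h1 h2 h3 h4 h5 hn h6 h7 h8 h9 S hsymm hSk
  have hn' : (0 : ℝ) < n := by exact_mod_cast hn
  set s : ℝ := 1 / √(n : ℝ) with hs
  have hs0 : 0 < s := by positivity
  have hk0 : 0 ≤ K * s := by positivity
  have hr0 : 0 < M * s := by positivity
  rw [Real.norm_eq_abs, Real.norm_eq_abs, abs_of_pos hs0] at h5
  have haS : aSeq pen (toU e) n ≤ A * s := (le_abs_self _).trans h5
  have hsphere : ∀ D, SuppIn e.1 D → sumSq D = (M * s) ^ 2 →
      avgObj (pen n) S (toU e + D) < avgObj (pen n) S (toU e) := fun D hD hDr =>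
    avgObj_lt_on_sphere hS he hn hcoer hK hM0 hA hC0 hs hkey h1 h3 haS h7 h8 hsymm hSk hD hDr
  obtain ⟨U, hU, hUr, hmax⟩ := exists_max_of_sphere (S := S)
    (((hconc n).continuousOn_interior).mono (by rw [interior_Ici])) hr0 (suppIn_toU he.2.1) h1 h2
    hsphere
  refine ⟨U, isLocalMaxOn_of_subspace hS he (κ := c' * lam n) hsymm hk0 hSk
    (quad_nonneg_of_close hcoer hk0 (by linarith) hSk) hr0 h1 h2 (hzero n) h4 ?_ hU hUr hmax⟩
  rw [← hC0, ← hC1]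
  have hl : (K * (C0 + p) + C1 * M) * s ≤ c' * lam n := by
    rw [div_le_iff₀ hc'] at h9
    have : lam n = lam n * √(n : ℝ) * s := by
      rw [hs]; field_simp
    rw [this]
    nlinarith
  have h10 : K * s * (C0 + p * (M * s)) ≤ K * s * (C0 + p) := by
    refine mul_le_mul_of_nonneg_left ?_ hk0
    have : (p : ℝ) * (M * s) ≤ p * 1 := mul_le_mul_of_nonneg_left h6 (by positivity)
    linarith
  nlinarith

end Existence

/-! ### Rates of the parametrizations -/

section Rates

variable {p : ℕ} {Sigma0 : Matrix (Fin p) (Fin p) ℝ}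
  {e : Matrix (Fin p) (Fin p) ℝ × Matrix (Fin p) (Fin p) ℝ} {pen : ℕ → ℝ → ℝ}
  {S : Type*} [MeasurableSpace S] {P : Measure S} {Uhat : ℕ → S → Matrix (Fin p) (Fin p) ℝ}

lemma frobNorm_eq (A : Matrix (Fin p) (Fin p) ℝ) : frobNorm A = √(sumSq A) := by
  rw [frobNorm, Matrix.frobenius_norm_def, Real.sqrt_eq_rpow, sumSq]
  simp

lemma frobNorm_nonneg (A : Matrix (Fin p) (Fin p) ℝ) : 0 ≤ frobNorm A := by
  rw [frobNorm_eq]; positivity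

lemma abs_apply_le_frobNorm (A : Matrix (Fin p) (Fin p) ℝ) (i j : Fin p) :
    |A i j| ≤ frobNorm A := by
  rw [frobNorm_eq]
  exact Real.abs_le_sqrt (sq_le_sumSq A i j)

lemma frobNorm_le_sumAbs (A : Matrix (Fin p) (Fin p) ℝ) : frobNorm A ≤ sumAbs A := by
  rw [frobNorm_eq]
  refine Real.sqrt_le_iff.2 ⟨sumAbs_nonneg A, ?_⟩
  have h : ∀ i j, |A i j| ≤ sumAbs A := fun i j =>
    (Finset.single_le_sum (f := fun j => |A i j|) (fun _ _ => abs_nonneg _)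
      (Finset.mem_univ j)).trans (sum_row_le_sumAbs A i)
  calc sumSq A = ∑ i, ∑ j, |A i j| * |A i j| := by simp only [sumSq, abs_mul_abs_self, sq]
    _ ≤ ∑ i, ∑ j, |A i j| * sumAbs A :=
        Finset.sum_le_sum fun i _ => Finset.sum_le_sum fun j _ =>
          mul_le_mul_of_nonneg_left (h i j) (abs_nonneg _)
    _ = sumAbs A ^ 2 := by simp only [← Finset.sum_mul, sumAbs, sq]

lemma isBigOP_frobNorm {A : ℕ → S → Matrix (Fin p) (Fin p) ℝ} {r : ℕ → ℝ} (hr : ∀ n, 0 ≤ r n)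
    (h : ∀ i j, IsBigOP P (fun n ω => A n ω i j) r) :
    IsBigOP P (fun n ω => frobNorm (A n ω)) r := by
  have hs : IsBigOP P (fun n ω => sumAbs (A n ω)) r :=
    IsBigOP.sum _ hr fun i _ => IsBigOP.sum _ hr fun j _ => (h i j).abs
  refine hs.mono fun n ω => ?_
  rw [abs_of_nonneg (frobNorm_nonneg _), abs_of_nonneg (sumAbs_nonneg _)]
  exact frobNorm_le_sumAbs _

lemma isBigOP_toB_sub (he : e ∈ equivClass Sigma0⁻¹)
    (hU : ∀ i j, IsBigOP P (fun n ω => Uhat n ω i j - toU e i j) fun n => 1 / √(n : ℝ))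
    (i j : Fin p) :
    IsBigOP P (fun n ω => (toB (Uhat n ω) - e.1) i j) fun n => 1 / √(n : ℝ) := by
  conv in e.1 => rw [← toB_toU he.1 he.2.1]
  by_cases hij : i = j
  · exact .of_bound 0 (by simp [toB, hij])
  · simp only [Matrix.sub_apply, toB, hij, if_false]
    exact IsBigOP.delta (y := toU e i j) (z := toU e j j) rate_nonneg tendsto_rate
      (fun x => x.1 / x.2) (by fun_prop (disch := exact (toU_diag_pos he.2.1 j).ne')) (hU i j) (hU j j)

lemma isBigOP_toOmega_sub (he : e ∈ equivClass Sigma0⁻¹)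
    (hU : ∀ i j, IsBigOP P (fun n ω => Uhat n ω i j - toU e i j) fun n => 1 / √(n : ℝ))
    (i j : Fin p) :
    IsBigOP P (fun n ω => (toOmega (Uhat n ω) - e.2) i j) fun n => 1 / √(n : ℝ) := by
  conv in e.2 => rw [← toOmega_toU he.2.1]
  by_cases hij : i = j
  · subst hij
    simp only [Matrix.sub_apply, toOmega, Matrix.diagonal_apply_eq]
    exact IsBigOP.delta (y := toU e i i) (z := toU e i i) rate_nonneg tendsto_rate
      (fun x => 1 / x.1 ^ 2) (by fun_prop (disch := exact pow_ne_zero 2 (toU_diag_pos he.2.1 i).ne')) (hU i i) (hU i i)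
  · exact .of_bound 0 (by simp [toOmega, hij])

lemma isBigOP_resid_sub
    (hU : ∀ i j, IsBigOP P (fun n ω => Uhat n ω i j - toU e i j) fun n => 1 / √(n : ℝ))
    (i j : Fin p) :
    IsBigOP P (fun n ω => resid (Uhat n ω) i j - resid (toU e) i j) fun n => 1 / √(n : ℝ) := by
  refine (hU i j).mono fun n ω => le_of_eq ?_
  by_cases hij : i = j
  · simp [resid, hij]
  · simp only [resid, hij, if_false]
    rw [neg_sub_neg, abs_sub_comm]

lemma isBigOP_thetaOf_sub (he : e ∈ equivClass Sigma0⁻¹)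
    (hU : ∀ i j, IsBigOP P (fun n ω => Uhat n ω i j - toU e i j) fun n => 1 / √(n : ℝ))
    (hdag : WithProbToOne P fun n ω => Uhat n ω ∈ dagSpace p) (i j : Fin p) :
    IsBigOP P (fun n ω => (thetaOf (toB (Uhat n ω)) (toOmega (Uhat n ω)) - Sigma0⁻¹) i j)
      fun n => 1 / √(n : ℝ) := by
  have h : IsBigOP P (fun n ω => ∑ l, resid (Uhat n ω) i l * resid (Uhat n ω) j l
      - ∑ l, resid (toU e) i l * resid (toU e) j l) fun n => 1 / √(n : ℝ) :=
    IsBigOP.sum_sub _ rate_nonneg fun l _ => IsBigOP.mul_sub rate_nonneg tendsto_rate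
      (isBigOP_resid_sub hU i l) (isBigOP_resid_sub hU j l)
  refine h.of_withProbToOne (hdag.mono (Eventually.of_forall fun n ω hω => le_of_eq ?_))
  rw [← resid_mul_transpose hω.2, ← resid_toU_mul_transpose he]
  simp only [Matrix.sub_apply, Matrix.mul_apply, Matrix.transpose_apply]

/-- The rate for `(B, Ω)` gives the same rate for `U`. -/
lemma isBigOP_sub_toU (he : e ∈ equivClass Sigma0⁻¹)
    (hdag : WithProbToOne P fun n ω => Uhat n ω ∈ dagSpace p)
    (hrate : IsBigOP P
      (fun n ω => frobNorm (toB (Uhat n ω) - e.1) + frobNorm (toOmega (Uhat n ω) - e.2))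
      fun n => 1 / √(n : ℝ)) (i j : Fin p) :
    IsBigOP P (fun n ω => Uhat n ω i j - toU e i j) fun n => 1 / √(n : ℝ) := by
  have hB : IsBigOP P (fun n ω => toB (Uhat n ω) i j - e.1 i j) fun n => 1 / √(n : ℝ) :=
    hrate.mono fun n ω => by
      rw [abs_of_nonneg (add_nonneg (frobNorm_nonneg _) (frobNorm_nonneg _))]
      have := abs_apply_le_frobNorm (toB (Uhat n ω) - e.1) i j
      have := frobNorm_nonneg (toOmega (Uhat n ω) - e.2)
      rw [Matrix.sub_apply] at *
      linarith
  have hO : IsBigOP P (fun n ω => toOmega (Uhat n ω) j j - e.2 j j) fun n => 1 / √(n : ℝ) :=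
    hrate.mono fun n ω => by
      rw [abs_of_nonneg (add_nonneg (frobNorm_nonneg _) (frobNorm_nonneg _))]
      have := abs_apply_le_frobNorm (toOmega (Uhat n ω) - e.2) j j
      have := frobNorm_nonneg (toB (Uhat n ω) - e.1)
      rw [Matrix.sub_apply] at *
      linarith
  have hpos : 0 < e.2 j j := by
    obtain ⟨d, hd, h⟩ := he.2.1
    rw [h, Matrix.diagonal_apply_eq]; exact hd j
  have hpos0 : e.2 j j ≠ 0 := hpos.ne'
  have hsqrt0 : √(e.2 j j) ≠ 0 := (Real.sqrt_pos.2 hpos).ne'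
  have h : IsBigOP P (fun n ω => toU (toB (Uhat n ω), toOmega (Uhat n ω)) i j - toU e i j)
      fun n => 1 / √(n : ℝ) := by
    by_cases hij : i = j
    · simp only [toU, hij, if_true]
      exact IsBigOP.delta (y := e.1 i j) (z := e.2 j j) rate_nonneg tendsto_rate
        (fun x => 1 / √x.2) (by fun_prop (disch := assumption)) hB hO
    · simp only [toU, hij, if_false]
      exact IsBigOP.delta (y := e.1 i j) (z := e.2 j j) rate_nonneg tendsto_rate
        (fun x => x.1 / √x.2) (by fun_prop (disch := assumption)) hB hO
  refine h.of_withProbToOne (hdag.mono (Eventually.of_forall fun n ω hω => le_of_eq ?_))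
  rw [toU_toB_toOmega hω.2]

lemma matSupp_toB_eq_iff (he : e ∈ equivClass Sigma0⁻¹) {U : Matrix (Fin p) (Fin p) ℝ}
    (hU : ∀ j, 0 < U j j) :
    matSupp (toB U) = matSupp e.1 ↔ ∀ i j, i ≠ j → (U i j ≠ 0 ↔ e.1 i j ≠ 0) := by
  have hoff : ∀ i j, i ≠ j → (toB U i j ≠ 0 ↔ U i j ≠ 0) := fun i j hij => by
    simp [toB, hij, (hU j).ne']
  rw [Set.ext_iff]
  constructor
  · intro h i j hij
    rw [← hoff i j hij]
    exact h (i, j)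
  · rintro h ⟨i, j⟩
    change toB U i j ≠ 0 ↔ e.1 i j ≠ 0
    by_cases hij : i = j
    · subst hij; simp [toB, he.1.apply_self]
    · rw [hoff i j hij, h i j hij]

end Rates

/-! ### The estimator attached to a DAG -/

section Estimator

variable {p : ℕ} {Sigma0 : Matrix (Fin p) (Fin p) ℝ}
  {e : Matrix (Fin p) (Fin p) ℝ × Matrix (Fin p) (Fin p) ℝ} {pen : ℕ → ℝ → ℝ} {lam : ℕ → ℝ}

/-- `U` is a local maximizer of the penalized likelihood over the DAG space which has the support
of `B` and lies within `M n^{-1/2}` of `U₀`. -/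
def IsNearMax {n p : ℕ} (q : ℝ → ℝ) (X : Matrix (Fin n) (Fin p) ℝ)
    (B U₀ : Matrix (Fin p) (Fin p) ℝ) (M : ℝ) (U : Matrix (Fin p) (Fin p) ℝ) : Prop :=
  U ∈ dagSpace p ∧ IsLocalMaxOn (penLogLik q X) (dagSpace p) U ∧
    (∀ i j, i ≠ j → (U i j ≠ 0 ↔ B i j ≠ 0)) ∧ ∀ i j, |U i j - U₀ i j| ≤ M * (1 / √(n : ℝ))

open Classical in
/-- A local maximizer with the support of `B` that is close to `U₀`, up to rounding the distance
on the scale `n^{-1/2}` to an integer, among all such local maximizers; zero if there is none. -/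
noncomputable def nearestMax {n p : ℕ} (q : ℝ → ℝ) (B U₀ : Matrix (Fin p) (Fin p) ℝ)
    (X : Matrix (Fin n) (Fin p) ℝ) : Matrix (Fin p) (Fin p) ℝ :=
  if h : ∃ m : ℕ, ∃ U, IsNearMax q X B U₀ m U then (Nat.find_spec h).choose else 0

lemma IsNearMax.mono {n : ℕ} {q : ℝ → ℝ} {X : Matrix (Fin n) (Fin p) ℝ}
    {B U₀ U : Matrix (Fin p) (Fin p) ℝ} {M M' : ℝ} (h : IsNearMax q X B U₀ M U) (hM : M ≤ M') :
    IsNearMax q X B U₀ M' U :=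
  ⟨h.1, h.2.1, h.2.2.1, fun i j => (h.2.2.2 i j).trans
    (mul_le_mul_of_nonneg_right hM (by positivity))⟩

lemma isNearMax_nearestMax {n : ℕ} {q : ℝ → ℝ} {X : Matrix (Fin n) (Fin p) ℝ}
    {B U₀ U : Matrix (Fin p) (Fin p) ℝ} {M : ℝ} (hU : IsNearMax q X B U₀ M U) :
    IsNearMax q X B U₀ ⌈M⌉₊ (nearestMax q B U₀ X) := by
  classical
  have hc : ∃ U, IsNearMax q X B U₀ (⌈M⌉₊ : ℕ) U := ⟨U, hU.mono (Nat.le_ceil M)⟩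
  have h : ∃ m : ℕ, ∃ U, IsNearMax q X B U₀ m U := ⟨_, hc⟩
  rw [nearestMax, dif_pos h]
  exact (Nat.find_spec h).choose_spec.mono (by exact_mod_cast Nat.find_min' h hc)

lemma isConsistentLocalMax_nearestMax {S : Type*} [MeasurableSpace S] {P : Measure S}
    [IsProbabilityMeasure P] {X : ℕ → S → EuclideanSpace ℝ (Fin p)} (hSigma0 : Sigma0.PosDef)
    (hindep : iIndepFun X P) (hlaw : ∀ k, HasLaw (X k) (multivariateGaussian 0 Sigma0) P)
    (he : e ∈ equivClass Sigma0⁻¹)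
    (hconc : ∀ n, ConcaveOn ℝ (Set.Ici 0) (pen n)) (hzero : ∀ n, pen n 0 = 0)
    (hliminf : 0 < liminf (fun n =>
      liminf (fun t : ℝ => ((deriv (pen n) t / lam n : ℝ) : EReal)) (𝓝[>] 0)) atTop)
    (ha : aSeq pen (toU e) =O[atTop] fun n : ℕ => 1 / √(n : ℝ))
    (hb : Tendsto (bSeq pen (toU e)) atTop (𝓝 0))
    (hexp : ∀ i j, phiOf (toU e) i j ≠ 0 → SecondOrderExpansion pen |phiOf (toU e) i j|)
    (hlam : Tendsto (fun n : ℕ => lam n * √(n : ℝ)) atTop atTop) :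
    IsConsistentLocalMax P X pen Sigma0⁻¹ e.1 e.2
      fun n ω => nearestMax (pen n) e.1 (toU e) (dataMatrix X n ω) := by
  have hS : IsUnit Sigma0.det := hSigma0.isUnit.map Matrix.detMonoidHom
  have hdev : IsBigOP P (fun n ω => sumAbs (sampleCov (dataMatrix X n ω) - Sigma0))
      (fun n => 1 / √(n : ℝ)) :=
    IsBigOP.sum _ rate_nonneg fun i _ => IsBigOP.sum _ rate_nonneg fun j _ =>
      (isBigOP_sampleCov_sub hSigma0.posSemidef hindep hlaw i j).abs
  have key : ∀ K : ℝ, ∃ M : ℝ, ∀ᶠ n : ℕ in atTop, ∀ ω,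
      |sumAbs (sampleCov (dataMatrix X n ω) - Sigma0)| ≤ K * (1 / √(n : ℝ)) →
      IsNearMax (pen n) (dataMatrix X n ω) e.1 (toU e) M
        (nearestMax (pen n) e.1 (toU e) (dataMatrix X n ω)) := by
    intro K
    obtain ⟨M, hM⟩ := exists_localMax hS he hconc hzero hliminf ha hb hexp hlam
      (K := max 1 K) (by positivity)
    refine ⟨⌈M⌉₊, ?_⟩
    filter_upwards [hM, eventually_gt_atTop 0] with n hn hn0 ω hω
    obtain ⟨U, h1, h2, h3, h4⟩ := hn (sampleCov (dataMatrix X n ω))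
      (by ext i j; exact sampleCov_symm _ _ _) fun i j => by
        rw [abs_of_nonneg (sumAbs_nonneg _)] at hω
        refine le_trans ?_ (hω.trans (mul_le_mul_of_nonneg_right (le_max_right 1 K)
          (rate_nonneg n)))
        exact (abs_apply_le_frobNorm (sampleCov (dataMatrix X n ω) - Sigma0) i j).trans
          (frobNorm_le_sumAbs _)
    refine isNearMax_nearestMax (U := U) ⟨h1, ?_, h3, h4⟩
    refine Eventually.mono h2 fun U' hU' => ?_
    rw [penLogLik_eq hn0, penLogLik_eq hn0]
    exact mul_le_mul_of_nonneg_left hU' (Nat.cast_nonneg n)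
  have hlocal : WithProbToOne P fun n ω =>
      nearestMax (pen n) e.1 (toU e) (dataMatrix X n ω) ∈ dagSpace p ∧
      IsLocalMaxOn (penLogLik (pen n) (dataMatrix X n ω)) (dagSpace p)
        (nearestMax (pen n) e.1 (toU e) (dataMatrix X n ω)) :=
    hdev.withProbToOne fun K => by
      obtain ⟨M, hM⟩ := key K
      filter_upwards [hM] with n hn ω hω
      exact ⟨(hn ω hω).1, (hn ω hω).2.1⟩
  have hentry : ∀ i j, IsBigOP P (fun n ω =>
      nearestMax (pen n) e.1 (toU e) (dataMatrix X n ω) i j - toU e i j)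
      fun n => 1 / √(n : ℝ) := fun i j => hdev.transfer fun K => by
    obtain ⟨M, hM⟩ := key K
    refine ⟨M, ?_⟩
    filter_upwards [hM] with n hn ω hω
    exact (hn ω hω).2.2.2 i j
  refine ⟨hlocal, ?_, ?_, ?_⟩
  · exact (isBigOP_frobNorm rate_nonneg (isBigOP_toB_sub he hentry)).add rate_nonneg
      (isBigOP_frobNorm rate_nonneg (isBigOP_toOmega_sub he hentry))
  · refine hdev.withProbToOne fun K => ?_
    obtain ⟨M, hM⟩ := key K
    filter_upwards [hM] with n hn ω hω
    exact (matSupp_toB_eq_iff he (hn ω hω).1.2).2 (hn ω hω).2.2.1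
  · exact isBigOP_frobNorm rate_nonneg (isBigOP_thetaOf_sub he hentry
      (hlocal.mono (Eventually.of_forall fun n ω h => h.1)))

end Estimator

/-! ### Comparison of the local maximizers -/

section Comparison

variable {p : ℕ} {Sigma0 : Matrix (Fin p) (Fin p) ℝ}
  {e : Matrix (Fin p) (Fin p) ℝ × Matrix (Fin p) (Fin p) ℝ} {pen : ℕ → ℝ → ℝ}

lemma exists_tau_bound (hzero : ∀ n, pen n 0 = 0)
    (htau_fin : limsup (tauSeq pen) atTop < ⊤) :
    ∃ T : ℝ, 0 < T ∧ ∀ᶠ n in atTop, (tauSeq pen n).toReal ≤ T ∧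
      ∀ t, 0 ≤ t → pen n t ≤ (tauSeq pen n).toReal := by
  obtain ⟨T, hT, -⟩ := EReal.lt_iff_exists_real_btwn.1 htau_fin
  refine ⟨max 1 T, by positivity, ?_⟩
  filter_upwards [eventually_lt_of_limsup_lt hT] with n hn
  have hle : ∀ t, 0 ≤ t → ((pen n t : ℝ) : EReal) ≤ tauSeq pen n := fun t ht =>
    le_iSup (fun t : {t : ℝ // 0 ≤ t} => ((pen n t : ℝ) : EReal)) ⟨t, ht⟩
  have hbot : tauSeq pen n ≠ ⊥ := by
    have h0 := hle 0 le_rfl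
    rw [hzero] at h0
    exact ne_bot_of_le_ne_bot (EReal.coe_ne_bot _) h0
  have hcoe := EReal.coe_toReal hn.ne_top hbot
  rw [← hcoe] at hn hle
  refine ⟨?_, fun t ht => by exact_mod_cast hle t ht⟩
  have : (tauSeq pen n).toReal < T := by exact_mod_cast hn
  exact this.le.trans (le_max_right 1 T)

/-- A nondecreasing concave function that vanishes at zero decreases at most proportionally when
its argument shrinks. -/
lemma sub_le_of_concave {f : ℝ → ℝ} (hmono : MonotoneOn f (Set.Ici 0))
    (hconc : ConcaveOn ℝ (Set.Ici 0) f) (h0 : f 0 = 0) {t s : ℝ} (ht : 0 < t) (hs : 0 ≤ s) :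
    f t - f s ≤ |s - t| / t * f t := by
  have hft : 0 ≤ f t := by
    have := hmono (show (0 : ℝ) ∈ Set.Ici 0 by simp) (show t ∈ Set.Ici 0 from ht.le) ht.le
    rwa [h0] at this
  rcases le_total t s with h | h
  · have := hmono (show t ∈ Set.Ici 0 from ht.le) (show s ∈ Set.Ici 0 from hs) h
    have h2 : 0 ≤ |s - t| / t * f t := by positivity
    linarith
  · have h1 : s / t ≤ 1 := (div_le_one ht).2 h
    have h2 := hconc.2 (show t ∈ Set.Ici 0 from ht.le) (show (0 : ℝ) ∈ Set.Ici 0 by simp)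
      (show 0 ≤ s / t by positivity) (show 0 ≤ 1 - s / t by linarith) (by ring)
    simp only [smul_eq_mul, mul_zero, add_zero, h0, div_mul_cancel₀ _ ht.ne'] at h2
    rw [abs_of_nonpos (by linarith)]
    have h3 : -(s - t) / t = 1 - s / t := by field_simp; ring
    rw [h3]
    linarith

/-- The penalty of an entry that estimates an edge differs from `τ` by at most a constant times
`n^{-1/2}` plus the estimation error. -/
lemma exists_tau_sub_pen_le (he : e ∈ equivClass Sigma0⁻¹)
    (hmono : ∀ n, MonotoneOn (pen n) (Set.Ici 0))
    (hconc : ∀ n, ConcaveOn ℝ (Set.Ici 0) (pen n)) (hzero : ∀ n, pen n 0 = 0)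
    (hc : (matSupp e.1).Nonempty →
      (fun n => cSeq pen (toU e) n - (tauSeq pen n).toReal) =O[atTop] fun n : ℕ => 1 / √(n : ℝ))
    (htau_fin : limsup (tauSeq pen) atTop < ⊤) {i j : Fin p} (hij : i ≠ j) (h : e.1 i j ≠ 0) :
    ∃ C : ℝ, ∀ᶠ n : ℕ in atTop, ∀ x : ℝ, |pen n |x| - (tauSeq pen n).toReal|
      ≤ C * (1 / √(n : ℝ)) + C * |x - toU e i j| := by
  obtain ⟨C, hC, hCb⟩ := (hc ⟨(i, j), h⟩).exists_pos
  obtain ⟨T, hT, hTb⟩ := exists_tau_bound hzero htau_fin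
  have hne := (toU_ne_zero_iff he.2.1 hij).2 h
  have ht : 0 < |toU e i j| := abs_pos.2 hne
  set C' := T / |toU e i j| with hC'
  have hC'0 : 0 < C' := by positivity
  refine ⟨max C C', ?_⟩
  filter_upwards [hCb.bound, hTb] with n h1 h2 x
  rw [Real.norm_eq_abs, Real.norm_eq_abs, abs_of_nonneg (rate_nonneg n)] at h1
  have h3 := h2.2 |x| (abs_nonneg x)
  have h4 := cSeq_le pen hij hne n
  have h5 := sub_le_of_concave (hmono n) (hconc n) (hzero n) ht (abs_nonneg x)
  have h6 : pen n |toU e i j| ≤ T := (h2.2 _ (abs_nonneg _)).trans h2.1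
  have h7 : |(|x| - |toU e i j|)| / |toU e i j| * pen n |toU e i j| ≤ C' * |x - toU e i j| := by
    calc _ ≤ |(|x| - |toU e i j|)| / |toU e i j| * T :=
          mul_le_mul_of_nonneg_left h6 (by positivity)
      _ = C' * |(|x| - |toU e i j|)| := by rw [hC']; ring
      _ ≤ _ := mul_le_mul_of_nonneg_left (abs_abs_sub_abs_le_abs_sub _ _) hC'0.le
  have h8 : C * (1 / √(n : ℝ)) ≤ max C C' * (1 / √(n : ℝ)) :=
    mul_le_mul_of_nonneg_right (le_max_left _ _) (rate_nonneg n)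
  have h9 : C' * |x - toU e i j| ≤ max C C' * |x - toU e i j| :=
    mul_le_mul_of_nonneg_right (le_max_right _ _) (abs_nonneg _)
  rw [abs_of_nonpos (by linarith)]
  have := (abs_le.1 h1).1
  linarith

lemma numEdges_mul_eq_sum (hB : IsDAG e.1) (τ : ℝ) :
    (numEdges e.1 : ℝ) * τ = ∑ i, ∑ j, if i = j then 0 else if e.1 i j = 0 then 0 else τ := by
  classical
  have h1 : numEdges e.1 = (Finset.univ.filter fun x : Fin p × Fin p => e.1 x.1 x.2 ≠ 0).card := by
    rw [numEdges, ← Set.ncard_coe_finset]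
    congr 1
    ext x; simp [matSupp]
  rw [h1, ← nsmul_eq_mul, ← Finset.sum_const, Finset.sum_filter,
    ← Finset.univ_product_univ, Finset.sum_product]
  refine Finset.sum_congr rfl fun i _ => Finset.sum_congr rfl fun j _ => ?_
  by_cases hij : i = j
  · subst hij; simp [hB.apply_self]
  · by_cases h0 : e.1 i j = 0 <;> simp [hij, h0]

/-- The population log-likelihood is the same at all members of the equivalence class. -/
lemma avgLogLik_toU (he : e ∈ equivClass Sigma0⁻¹) :
    avgLogLik Sigma0 (toU e)
      = Real.log Sigma0⁻¹.det / 2 - (1 / 2) * (Sigma0 * Sigma0⁻¹).trace := by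
  rw [avgLogLik, sum_log_toU he, quad, Matrix.trace_mul_comm, Matrix.mul_assoc,
    resid_toU_mul_transpose he]

variable {S : Type*} [MeasurableSpace S] {P : Measure S}
  {X : ℕ → S → EuclideanSpace ℝ (Fin p)} {Uhat : ℕ → S → Matrix (Fin p) (Fin p) ℝ}

lemma isBigOP_avgLogLik_sub [IsProbabilityMeasure P] (hSigma0 : Sigma0.PosDef)
    (hindep : iIndepFun X P) (hlaw : ∀ k, HasLaw (X k) (multivariateGaussian 0 Sigma0) P)
    (he : e ∈ equivClass Sigma0⁻¹)
    (hU : ∀ i j, IsBigOP P (fun n ω => Uhat n ω i j - toU e i j) fun n => 1 / √(n : ℝ)) :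
    IsBigOP P (fun n ω => avgLogLik (sampleCov (dataMatrix X n ω)) (Uhat n ω)
      - avgLogLik Sigma0 (toU e)) fun n => 1 / √(n : ℝ) := by
  have hlog : IsBigOP P (fun n ω => ∑ j, Real.log (Uhat n ω j j) - ∑ j, Real.log (toU e j j))
      fun n => 1 / √(n : ℝ) := by
    refine IsBigOP.sum_sub _ rate_nonneg fun j _ => ?_
    exact IsBigOP.delta (y := toU e j j) (z := toU e j j) rate_nonneg tendsto_rate
      (fun x => Real.log x.1) (by fun_prop (disch := exact (toU_diag_pos he.2.1 j).ne'))
      (hU j j) (hU j j)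
  have hquad : IsBigOP P (fun n ω => quad (sampleCov (dataMatrix X n ω)) (resid (Uhat n ω))
      (resid (Uhat n ω)) - quad Sigma0 (resid (toU e)) (resid (toU e)))
      fun n => 1 / √(n : ℝ) := by
    simp only [quad_eq_sum₃]
    refine IsBigOP.sum_sub _ rate_nonneg fun j _ => IsBigOP.sum_sub _ rate_nonneg fun i _ =>
      IsBigOP.sum_sub _ rate_nonneg fun l _ => ?_
    exact IsBigOP.mul_sub rate_nonneg tendsto_rate (isBigOP_resid_sub hU i j)
      (IsBigOP.mul_sub rate_nonneg tendsto_rate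
        (isBigOP_sampleCov_sub hSigma0.posSemidef hindep hlaw i l) (isBigOP_resid_sub hU l j))
  refine (hlog.sub rate_nonneg (hquad.const_mul (1 / 2))).mono fun n ω => le_of_eq ?_
  rw [avgLogLik, avgLogLik]
  congr 1; ring

lemma isBigOP_penalty_sub (he : e ∈ equivClass Sigma0⁻¹)
    (hmono : ∀ n, MonotoneOn (pen n) (Set.Ici 0))
    (hconc : ∀ n, ConcaveOn ℝ (Set.Ici 0) (pen n)) (hzero : ∀ n, pen n 0 = 0)
    (hc : (matSupp e.1).Nonempty →
      (fun n => cSeq pen (toU e) n - (tauSeq pen n).toReal) =O[atTop] fun n : ℕ => 1 / √(n : ℝ))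
    (htau_fin : limsup (tauSeq pen) atTop < ⊤)
    (hdag : WithProbToOne P fun n ω => Uhat n ω ∈ dagSpace p)
    (hsupp : WithProbToOne P fun n ω => matSupp (toB (Uhat n ω)) = matSupp e.1)
    (hU : ∀ i j, IsBigOP P (fun n ω => Uhat n ω i j - toU e i j) fun n => 1 / √(n : ℝ)) :
    IsBigOP P (fun n ω => (∑ i, ∑ j, if i = j then 0 else pen n |Uhat n ω i j|)
      - numEdges e.1 * (tauSeq pen n).toReal) fun n => 1 / √(n : ℝ) := by
  simp only [numEdges_mul_eq_sum he.1, ← Finset.sum_sub_distrib]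
  refine IsBigOP.sum _ rate_nonneg fun i _ => IsBigOP.sum _ rate_nonneg fun j _ => ?_
  have hz : IsBigOP P (fun _ _ => (0 : ℝ)) fun n : ℕ => 1 / √(n : ℝ) := .of_bound 0 (by simp)
  by_cases hij : i = j
  · simpa [hij] using hz
  simp only [hij, if_false]
  by_cases h0 : e.1 i j = 0
  · refine hz.of_withProbToOne ((hdag.and hsupp).mono (Eventually.of_forall fun n ω hω => ?_))
    have : Uhat n ω i j = 0 := by
      by_contra hne
      exact ((matSupp_toB_eq_iff he hω.1.2).1 hω.2 i j hij).1 hne h0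
    simp [h0, this, hzero]
  · simp only [h0, if_false]
    obtain ⟨C, hC⟩ := exists_tau_sub_pen_le he hmono hconc hzero hc htau_fin hij h0
    refine (hU i j).transfer fun K => ⟨|C| + |C| * K, ?_⟩
    filter_upwards [hC] with n hn ω hω
    have h1 := hn (Uhat n ω i j)
    have h2 : C * (1 / √(n : ℝ)) ≤ |C| * (1 / √(n : ℝ)) :=
      mul_le_mul_of_nonneg_right (le_abs_self C) (rate_nonneg n)
    have h3 : C * |Uhat n ω i j - toU e i j| ≤ |C| * (K * (1 / √(n : ℝ))) :=
      mul_le_mul (le_abs_self C) hω (abs_nonneg _) (abs_nonneg _)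
    linarith

/-- At a consistent local maximizer, the penalized likelihood per observation is, up to `O_P(n^{-1/2})`, a constant
that is common to the equivalence class, minus `τ` for each edge. -/
lemma isBigOP_avgObj_sub [IsProbabilityMeasure P] (hSigma0 : Sigma0.PosDef)
    (hindep : iIndepFun X P) (hlaw : ∀ k, HasLaw (X k) (multivariateGaussian 0 Sigma0) P)
    (he : e ∈ equivClass Sigma0⁻¹)
    (hmono : ∀ n, MonotoneOn (pen n) (Set.Ici 0))
    (hconc : ∀ n, ConcaveOn ℝ (Set.Ici 0) (pen n)) (hzero : ∀ n, pen n 0 = 0)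
    (hc : (matSupp e.1).Nonempty →
      (fun n => cSeq pen (toU e) n - (tauSeq pen n).toReal) =O[atTop] fun n : ℕ => 1 / √(n : ℝ))
    (htau_fin : limsup (tauSeq pen) atTop < ⊤)
    (hU : IsConsistentLocalMax P X pen Sigma0⁻¹ e.1 e.2 Uhat) :
    IsBigOP P (fun n ω => avgObj (pen n) (sampleCov (dataMatrix X n ω)) (Uhat n ω)
      - ((Real.log Sigma0⁻¹.det / 2 - (1 / 2) * (Sigma0 * Sigma0⁻¹).trace)
        - numEdges e.1 * (tauSeq pen n).toReal)) fun n => 1 / √(n : ℝ) := by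
  have hdag : WithProbToOne P fun n ω => Uhat n ω ∈ dagSpace p :=
    hU.localMax.mono (Eventually.of_forall fun n ω h => h.1)
  have hentry := isBigOP_sub_toU he hdag hU.rate
  refine ((isBigOP_avgLogLik_sub hSigma0 hindep hlaw he hentry).sub rate_nonneg
    (isBigOP_penalty_sub he hmono hconc hzero hc htau_fin hdag hU.support hentry)).mono
    fun n ω => le_of_eq ?_
  rw [avgObj, ← avgLogLik_toU he]
  congr 1; ring

end Comparison

theorem theorem4 {p : ℕ} (hp : 1 ≤ p)
    (Sigma0 : Matrix (Fin p) (Fin p) ℝ) (hSigma0 : Sigma0.PosDef)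
    {S : Type*} [MeasurableSpace S] (P : Measure S) [IsProbabilityMeasure P]
    (X : ℕ → S → EuclideanSpace ℝ (Fin p))
    (hindep : iIndepFun X P)
    (hlaw : ∀ k, HasLaw (X k) (multivariateGaussian 0 Sigma0) P)
    (pen : ℕ → ℝ → ℝ) (lam : ℕ → ℝ)
    (hmono : ∀ n, MonotoneOn (pen n) (Set.Ici 0))
    (hconc : ∀ n, ConcaveOn ℝ (Set.Ici 0) (pen n))
    (hzero : ∀ n, pen n 0 = 0)
    (hliminf : 0 < liminf (fun n =>
      liminf (fun t : ℝ => ((deriv (pen n) t / lam n : ℝ) : EReal)) (𝓝[>] 0)) atTop)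
    (ha : ∀ e ∈ equivClass Sigma0⁻¹, aSeq pen (toU e) =O[atTop] fun n : ℕ => 1 / √(n : ℝ))
    (hb : ∀ e ∈ equivClass Sigma0⁻¹, Tendsto (bSeq pen (toU e)) atTop (𝓝 0))
    (hexp : ∀ e ∈ equivClass Sigma0⁻¹, ∀ i j, phiOf (toU e) i j ≠ 0 →
      SecondOrderExpansion pen |phiOf (toU e) i j|)
    (hc : ∀ e ∈ equivClass Sigma0⁻¹, (matSupp e.1).Nonempty →
      (fun n => cSeq pen (toU e) n - (tauSeq pen n).toReal) =O[atTop] fun n : ℕ => 1 / √(n : ℝ))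
    (hlam0 : Tendsto lam atTop (𝓝 0))
    (hlam : Tendsto (fun n : ℕ => lam n * √(n : ℝ)) atTop atTop)
    (htau_fin : limsup (tauSeq pen) atTop < ⊤)
    (htau : Tendsto (fun n : ℕ => (tauSeq pen n).toReal * √(n : ℝ)) atTop atTop) :
    (∀ π : Equiv.Perm (Fin p),
      ∃ est : (n : ℕ) → Matrix (Fin n) (Fin p) ℝ → Matrix (Fin p) (Fin p) ℝ,
        IsConsistentLocalMax P X pen Sigma0⁻¹ (Btilde Sigma0⁻¹ π) (OmegaTilde Sigma0⁻¹ π)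
          fun n ω => est n (dataMatrix X n ω)) ∧
    ∀ Uhat : Matrix (Fin p) (Fin p) ℝ × Matrix (Fin p) (Fin p) ℝ →
        ℕ → S → Matrix (Fin p) (Fin p) ℝ,
      (∀ e ∈ equivClass Sigma0⁻¹, IsConsistentLocalMax P X pen Sigma0⁻¹ e.1 e.2 (Uhat e)) →
      (WithProbToOne P fun n ω => ∃ s ∈ sparsestDAGs Sigma0⁻¹,
        IsGreatest ((fun e => penLogLik (pen n) (dataMatrix X n ω) (Uhat e n ω)) ''
            equivClass Sigma0⁻¹)
          (penLogLik (pen n) (dataMatrix X n ω) (Uhat s n ω))) ∧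
      (WithProbToOne P fun n ω => ∀ s ∈ sparsestDAGs Sigma0⁻¹, ∀ e ∈ equivClass Sigma0⁻¹,
        numEdges s.1 < numEdges e.1 →
        penLogLik (pen n) (dataMatrix X n ω) (Uhat e n ω) <
          penLogLik (pen n) (dataMatrix X n ω) (Uhat s n ω)) := by
  have hinv : (Sigma0⁻¹).PosDef := hSigma0.inv
  refine ⟨fun π => ?_, fun Uhat hUhat => ?_⟩
  · have he := tilde_mem_equivClass hinv π
    exact ⟨fun n => nearestMax (pen n) (Btilde Sigma0⁻¹ π)
        (toU (Btilde Sigma0⁻¹ π, OmegaTilde Sigma0⁻¹ π)),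
      isConsistentLocalMax_nearestMax hSigma0 hindep hlaw he hconc hzero hliminf (ha _ he)
        (hb _ he) (hexp _ he) hlam⟩
  -- Since `τ n^{1/2} → ∞`, one edge more costs more than the fluctuations of the likelihood.
  have hpair : ∀ s ∈ equivClass Sigma0⁻¹, ∀ e ∈ equivClass Sigma0⁻¹,
      WithProbToOne P fun n ω => numEdges s.1 < numEdges e.1 →
        penLogLik (pen n) (dataMatrix X n ω) (Uhat e n ω) <
          penLogLik (pen n) (dataMatrix X n ω) (Uhat s n ω) := by
    intro s hs e he
    have hse := (isBigOP_avgObj_sub hSigma0 hindep hlaw hs hmono hconc hzero (hc s hs) htau_fin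
      (hUhat s hs)).sub rate_nonneg (isBigOP_avgObj_sub hSigma0 hindep hlaw he hmono hconc hzero
      (hc e he) htau_fin (hUhat e he))
    refine hse.withProbToOne fun K => ?_
    filter_upwards [htau.eventually_gt_atTop (max 0 K), eventually_gt_atTop 0]
      with n hn hn0 ω hω hlt
    have hn' : (0 : ℝ) < n := by exact_mod_cast hn0
    have hsq : 0 < √(n : ℝ) := Real.sqrt_pos.2 hn'
    have hK : K * (1 / √(n : ℝ)) < (tauSeq pen n).toReal := by
      rw [mul_one_div, div_lt_iff₀ hsq]
      exact (le_max_right 0 K).trans_lt hn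
    have htau0 : 0 < (tauSeq pen n).toReal :=
      pos_of_mul_pos_left ((le_max_left 0 K).trans_lt hn) hsq.le
    have hedge : (numEdges s.1 : ℝ) + 1 ≤ numEdges e.1 := by exact_mod_cast hlt
    have hmul := mul_le_mul_of_nonneg_right hedge htau0.le
    rw [penLogLik_eq hn0, penLogLik_eq hn0]
    refine mul_lt_mul_of_pos_left ?_ hn'
    have := (abs_le.1 hω).1
    linarith
  have hall : WithProbToOne P fun n ω => ∀ s ∈ sparsestDAGs Sigma0⁻¹, ∀ e ∈ equivClass Sigma0⁻¹,
      numEdges s.1 < numEdges e.1 →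
        penLogLik (pen n) (dataMatrix X n ω) (Uhat e n ω) <
          penLogLik (pen n) (dataMatrix X n ω) (Uhat s n ω) :=
    withProbToOne_forall_finite ((equivClass_finite hinv).subset fun _ h => h.1) fun s hs =>
      withProbToOne_forall_finite (equivClass_finite hinv) fun e he => hpair s hs.1 e he
  refine ⟨hall.mono (Eventually.of_forall fun n ω hω => ?_), hall⟩
  have hne : (equivClass Sigma0⁻¹).Nonempty := ⟨_, tilde_mem_equivClass hinv 1⟩
  obtain ⟨s, hs, hsmin⟩ := Set.exists_min_image (equivClass Sigma0⁻¹) (fun e => numEdges e.1)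
    (equivClass_finite hinv) hne
  obtain ⟨m, hm, hmax⟩ := Set.exists_max_image (equivClass Sigma0⁻¹)
    (fun e => penLogLik (pen n) (dataMatrix X n ω) (Uhat e n ω)) (equivClass_finite hinv) hne
  refine ⟨m, ⟨hm, fun e he => ?_⟩, ⟨m, hm, rfl⟩, ?_⟩
  · have hms : numEdges m.1 ≤ numEdges s.1 := le_of_not_gt fun hlt =>
      (hω s ⟨hs, hsmin⟩ m hm hlt).not_ge (hmax s hs)
    exact hms.trans (hsmin e he)
  · rintro _ ⟨e, he, rfl⟩
    exact hmax e he
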